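/- Let $G$ be a plane triangulation, i.e. a finite connected simple graph with at least three vertices embedded in the plane so that every face (the outer face included) is bounded by a triangle; the embedding is taken combinatorially, as a rotation system (a cyclic order of the edges around each vertex) whose faces, obtained by face tracing, satisfy Euler's formula $|V|-|E|+|F|=2$. Let the vertices $x_1,\dots,x_n$ of $G$ be linearly ordered by their indices, and let $T$ be any triangle in $G$, i.e. any three pairwise adjacent vertices (not necessarily bounding a face), with edge set $E(T)$. Let $\mathbb F$ be an arbitrary field, and let every edge $e=x_ix_j$ $(i<j)$ of $G-E(T)$ be assigned an arbitrary pair $(a_e,b_e)$ of non-zero elements of $\mathbb F$. Then the decorated graph polynomial $$D_{G-E(T)}(x_1,\dots,x_n)=\prod_{e=x_ix_j\in E(G)\setminus E(T),\ i<j}(a_ex_i+b_ex_j)\in\mathbb F[x_1,\dots,x_n]$$ has a monomial $N$ with non-zero coefficient such that $\deg_u(N)=0$ for every vertex $u$ of $T$ and $\deg_w(N)\le 4$ for every other vertex $w$. -/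

import Mathlib

/-- A rotation system on a simple graph `G`, i.e. a combinatorial embedding of `G` in an oriented
surface: at every vertex `v` the darts (oriented edges) leaving `v` are put into one cyclic order.
`next d` is the dart that follows `d` in the rotation around its tail `d.fst`. -/
structure RotationSystem {V : Type*} (G : SimpleGraph V) where
  next : Equiv.Perm G.Dart
  fst_next : ∀ d : G.Dart, (next d).fst = d.fst
  sameCycle_of_fst_eq : ∀ d d' : G.Dart, d.fst = d'.fst → next.SameCycle d d'

namespace RotationSystem

variable {V : Type*} {G : SimpleGraph V}

/-- The face-tracing permutation: walk along the dart `d = (u, v)` and continue with the dart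
that follows the reversed dart `(v, u)` in the rotation around `v`. -/
def facePerm (R : RotationSystem G) : Equiv.Perm G.Dart :=
  (Function.Involutive.toPerm SimpleGraph.Dart.symm SimpleGraph.Dart.symm_involutive).trans R.next

/-- The faces of the embedding are the orbits of the face-tracing permutation. -/
def Face (R : RotationSystem G) : Type _ :=
  Quotient (Equiv.Perm.SameCycle.setoid R.facePerm)

/-- The embedding is plane (the surface is the sphere, i.e. the compactified plane): the graph is
connected and the Euler characteristic satisfies `|V| - |E| + |F| = 2`. -/
def IsPlane [Fintype V] (R : RotationSystem G) : Prop :=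
  G.Connected ∧ (Nat.card V : ℤ) - (Nat.card G.edgeSet : ℤ) + (Nat.card R.Face : ℤ) = 2

/-- A plane triangulation: a plane embedding all of whose faces (the outer one included) are
bounded by triangles, i.e. every face-tracing walk closes up after exactly three steps (it cannot
close up after one step because `G` has no loops). -/
def IsPlaneTriangulation [Fintype V] (R : RotationSystem G) : Prop :=
  R.IsPlane ∧ ∀ d : G.Dart, R.facePerm (R.facePerm (R.facePerm d)) = d

end RotationSystem

/-- A decoration of the edges of `H` over the field `F`: every edge `e` gets a pair
`(a e, b e)` of non-zero field elements (values outside the edge set are irrelevant). -/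
structure EdgeDecoration {V : Type*} (H : SimpleGraph V) (F : Type*) [Field F] where
  a : Sym2 V → F
  b : Sym2 V → F
  a_ne_zero : ∀ e ∈ H.edgeSet, a e ≠ 0
  b_ne_zero : ∀ e ∈ H.edgeSet, b e ≠ 0

open Classical in
/-- The decorated graph polynomial `∏ (a_e x_i + b_e x_j)` over the edges `e = x_i x_j`, `i < j`,
of `H`. The two endpoints of `e` are `e.inf < e.sup`. -/
noncomputable def decoratedPolynomial {V : Type*} [Fintype V] [LinearOrder V]
    (H : SimpleGraph V) {F : Type*} [Field F] (δ : EdgeDecoration H F) : MvPolynomial V F :=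
  ∏ e ∈ H.edgeFinset,
    (MvPolynomial.C (δ.a e) * MvPolynomial.X e.inf + MvPolynomial.C (δ.b e) * MvPolynomial.X e.sup)

/-! The claim follows from a statement about triangulated disks. Let `S` be a set of faces whose
boundary is a simple closed curve, and let `xy` be an edge of that curve. Then the product of the
linear forms over the edges of `S` other than `xy` has a monomial in which `x` and `y` do not occur,
every boundary vertex has degree at most two and every vertex has degree at most four. The proof is
by induction on the number of faces; let `v` be the boundary vertex next to `x`, other than `y`.

* If some chord `vc` runs through `S`, it splits `S` into two smaller disks. Take a monomial for the
  disk through `xy` and one, avoiding `v` and `c`, for the other disk without `vc`. Their product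
  does not cancel, since all forms are homogeneous and the second monomial avoids all variables of
  the first disk.
* Otherwise `v` is removed together with its star: its neighbours form a path `x, u₁, …, uₖ, w`
  whose inner vertices are interior to `S` and end up on the boundary of the smaller disk. For a
  monomial `N` of the smaller disk take `v` from the form of `vx` and `uᵢ` from that of `vuᵢ`. If
  `v` can also be taken from the form of `vw`, this gives `N u₁ ⋯ uₖ v²`. If not, the cancellation
  forces `N = K w` with `K uᵢ` a monomial of the smaller disk for some `i`, and taking `w` from the
  form of `vw` gives `N u₁ ⋯ uₖ uᵢ v`.

For a plane embedding, Euler's formula makes the boundary map from sets of faces to cycles modulo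
two surjective; this is how a chord splits a disk and the triangle `T` splits the sphere into two
disks with boundary `T`. In the monomial of either disk the two edges of `T` at its third vertex
account for the whole degree two of that vertex, so the product over the remaining edges has a
monomial avoiding `T`, and the two monomials are multiplied.
-/

section Polynomials

open MvPolynomial

variable {V R : Type*} [CommSemiring R]

theorem coeff_add_single_linear_mul {v z : V} (hvz : v ≠ z) (a b : R) {M : V →₀ ℕ}
    (hM : M z = 0) (P : MvPolynomial V R) :
    coeff (M + Finsupp.single v 1) ((C a * X v + C b * X z) * P) = a * coeff M P := by
  classical
  rw [add_mul, coeff_add, mul_assoc, coeff_C_mul, mul_assoc, coeff_C_mul, coeff_X_mul',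
    coeff_X_mul', if_pos, if_neg]
  · simp
  · simp [hM, hvz]
  · simp

theorem exists_eq_add_single_of_mem_support_linear_mul {v z : V} {a b : R} {P : MvPolynomial V R}
    {N : V →₀ ℕ} (hNz : N z = 0) (hN : N ∈ ((C a * X v + C b * X z) * P).support) :
    ∃ M ∈ P.support, N = M + Finsupp.single v 1 := by
  classical
  rw [mem_support_iff, add_mul, coeff_add, mul_assoc, coeff_C_mul, mul_assoc, coeff_C_mul,
    coeff_X_mul', coeff_X_mul', if_neg (by simpa using hNz : z ∉ N.support), mul_zero,
    add_zero] at hN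
  split_ifs at hN with hv
  · exact ⟨_, mem_support_iff.2 (right_ne_zero_of_mul hN), (tsub_add_cancel_of_le
      (Finsupp.single_le_iff.2 (Nat.one_le_iff_ne_zero.2 (Finsupp.mem_support_iff.1 hv)))).symm⟩
  · simp at hN

theorem coeff_add_single_add_single_linear_mul (v z : V) (a b : R) (M : V →₀ ℕ)
    (P : MvPolynomial V R) :
    coeff (M + Finsupp.single v 1 + Finsupp.single z 1) ((C a * X v + C b * X z) * P) =
      a * coeff (M + Finsupp.single z 1) P + b * coeff (M + Finsupp.single v 1) P := by
  rw [add_mul, coeff_add, mul_assoc, coeff_C_mul, mul_assoc, coeff_C_mul, mul_comm (X v),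
    mul_comm (X z), add_right_comm, coeff_mul_X, add_right_comm, coeff_mul_X]

theorem sum_single_one_apply [DecidableEq V] (U : Finset V) (z : V) :
    (∑ u ∈ U, Finsupp.single u 1 : V →₀ ℕ) z = if z ∈ U then 1 else 0 := by
  simp [Finsupp.finsetSum_apply, Finsupp.single_apply]

theorem coeff_add_sum_single_prod_linear_mul {v : V} (a b : V → R) (P : MvPolynomial V R)
    {U : Finset V} (hvU : v ∉ U) {M : V →₀ ℕ} (hM : M v = 0) :
    coeff (M + ∑ u ∈ U, Finsupp.single u 1) ((∏ u ∈ U, (C (a u) * X v + C (b u) * X u)) * P) =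
      (∏ u ∈ U, b u) * coeff M P := by
  classical
  induction U using Finset.induction_on with
  | empty => simp
  | insert u U hu ih =>
    simp only [Finset.mem_insert, not_or] at hvU
    have hdeg : (M + ∑ u ∈ U, Finsupp.single u 1 : V →₀ ℕ) v = 0 := by
      rw [Finsupp.add_apply, hM, sum_single_one_apply, if_neg hvU.2]
    rw [Finset.sum_insert hu, Finset.prod_insert hu, Finset.prod_insert hu,
      add_comm (Finsupp.single u 1), ← add_assoc, add_comm (C (a u) * X v), mul_assoc,
      coeff_add_single_linear_mul (Ne.symm hvU.1) _ _ hdeg, ih hvU.2, mul_assoc]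

theorem exists_coeff_add_single_ne_zero_of_prod_linear_mul {v : V} {a b : V → R}
    {P : MvPolynomial V R} (hP : v ∉ P.vars) {U : Finset V} (hvU : v ∉ U) {M : V →₀ ℕ}
    (hM : M v = 0)
    (h : coeff (M + Finsupp.single v 1 + ∑ u ∈ U, Finsupp.single u 1)
      ((∏ u ∈ U, (C (a u) * X v + C (b u) * X u)) * P) ≠ 0) :
    ∃ u ∈ U, coeff (M + Finsupp.single u 1) P ≠ 0 := by
  classical
  induction U using Finset.induction_on with
  | empty =>
    have hMv : (M + Finsupp.single v 1 : V →₀ ℕ) v = 0 :=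
      mem_support_notMem_vars_zero (mem_support_iff.2 (by simpa using h)) hP
    simp at hMv
  | insert u U hu ih =>
    simp only [Finset.mem_insert, not_or] at hvU
    have hMu : (M + Finsupp.single u 1 : V →₀ ℕ) v = 0 := by
      simp [hM, Finsupp.single_eq_of_ne hvU.1]
    rw [Finset.sum_insert hu, Finset.prod_insert hu, mul_assoc,
      show M + Finsupp.single v 1 + (Finsupp.single u 1 + ∑ u ∈ U, Finsupp.single u 1) =
        M + ∑ u ∈ U, Finsupp.single u 1 + Finsupp.single v 1 + Finsupp.single u 1 by abel,
      coeff_add_single_add_single_linear_mul, add_right_comm M,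
      coeff_add_sum_single_prod_linear_mul a b P hvU.2 hMu, add_right_comm M] at h
    by_cases h' : coeff (M + Finsupp.single v 1 + ∑ u ∈ U, Finsupp.single u 1)
      ((∏ u ∈ U, (C (a u) * X v + C (b u) * X u)) * P) = 0
    · rw [h', mul_zero, add_zero] at h
      exact ⟨u, by simp, right_ne_zero_of_mul (right_ne_zero_of_mul h)⟩
    · obtain ⟨z, hz, hcoeff⟩ := ih hvU.2 h'
      exact ⟨z, Finset.mem_insert_of_mem hz, hcoeff⟩

theorem add_sum_single_mem_support_prod_linear_mul [NoZeroDivisors R] {v : V} {a b : V → R}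
    {P : MvPolynomial V R} (hP : v ∉ P.vars) {U : Finset V} (hvU : v ∉ U) (hb : ∀ u ∈ U, b u ≠ 0)
    {M : V →₀ ℕ} (hM : M ∈ P.support) :
    M + ∑ u ∈ U, Finsupp.single u 1 ∈
      ((∏ u ∈ U, (C (a u) * X v + C (b u) * X u)) * P).support := by
  have := nontrivial_of_ne _ _ (mem_support_iff.1 hM)
  rw [mem_support_iff,
    coeff_add_sum_single_prod_linear_mul a b P hvU (mem_support_notMem_vars_zero hM hP)]
  exact mul_ne_zero (Finset.prod_ne_zero_iff.2 hb) (mem_support_iff.1 hM)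

theorem exists_exchange_of_coeff_star_eq_zero [NoZeroDivisors R] {v w : V} {U : Finset V}
    (hvw : v ≠ w) (hvU : v ∉ U) (hwU : w ∉ U) {a b : V → R} (ha : a w ≠ 0) (hb : ∀ u ∈ U, b u ≠ 0)
    {P : MvPolynomial V R} (hP : v ∉ P.vars) {N : V →₀ ℕ} (hN : N ∈ P.support)
    (h : coeff (N + ∑ u ∈ U, Finsupp.single u 1 + Finsupp.single v 1)
      ((C (a w) * X v + C (b w) * X w) *
        ((∏ u ∈ U, (C (a u) * X v + C (b u) * X u)) * P)) = 0) :
    ∃ K, N = K + Finsupp.single w 1 ∧ ∃ u ∈ U, K + Finsupp.single u 1 ∈ P.support := by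
  classical
  have hNU := mem_support_iff.1 (add_sum_single_mem_support_prod_linear_mul (a := a) hP hvU hb hN)
  obtain hNw | hNw := eq_or_ne (N w) 0
  · have hdeg : (N + ∑ u ∈ U, Finsupp.single u 1 : V →₀ ℕ) w = 0 := by
      rw [Finsupp.add_apply, hNw, sum_single_one_apply, if_neg hwU]
    rw [coeff_add_single_linear_mul hvw _ _ hdeg] at h
    exact absurd h (mul_ne_zero ha hNU)
  obtain ⟨K, rfl⟩ : ∃ K, N = K + Finsupp.single w 1 :=
    ⟨N - Finsupp.single w 1, (tsub_add_cancel_of_le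
      (Finsupp.single_le_iff.2 (Nat.one_le_iff_ne_zero.2 hNw))).symm⟩
  have hKv : K v = 0 := by simpa [hvw] using mem_support_notMem_vars_zero hN hP
  refine ⟨K, rfl, ?_⟩
  simp only [mem_support_iff]
  refine exists_coeff_add_single_ne_zero_of_prod_linear_mul (a := a) (b := b) hP hvU hKv ?_
  intro hKU
  rw [add_right_comm K, add_right_comm _ _ (Finsupp.single v 1),
    coeff_add_single_add_single_linear_mul, add_right_comm K _ (Finsupp.single v 1), hKU, mul_zero,
    add_zero, add_right_comm K _ (Finsupp.single w 1)] at h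
  exact mul_ne_zero ha hNU h

theorem exists_add_single_mem_support_star_mul [NoZeroDivisors R] {v w : V} {U : Finset V}
    (hvw : v ≠ w) (hvU : v ∉ U) (hwU : w ∉ U) {a b : V → R} (ha : a w ≠ 0) (hbw : b w ≠ 0)
    (hb : ∀ u ∈ U, b u ≠ 0) {P : MvPolynomial V R} (hP : v ∉ P.vars) {N : V →₀ ℕ}
    (hN : N ∈ P.support) :
    ∃ t, (t = v ∨ t ∈ U) ∧ N + ∑ u ∈ U, Finsupp.single u 1 + Finsupp.single t 1 ∈
      ((C (a w) * X v + C (b w) * X w) *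
        ((∏ u ∈ U, (C (a u) * X v + C (b u) * X u)) * P)).support := by
  classical
  by_cases hv : coeff (N + ∑ u ∈ U, Finsupp.single u 1 + Finsupp.single v 1)
    ((C (a w) * X v + C (b w) * X w) * ((∏ u ∈ U, (C (a u) * X v + C (b u) * X u)) * P)) = 0
  · obtain ⟨K, rfl, u, hu, hKu⟩ :=
      exists_exchange_of_coeff_star_eq_zero hvw hvU hwU ha hb hP hN hv
    refine ⟨u, .inr hu, ?_⟩
    have hdeg : (K + Finsupp.single u 1 + ∑ u ∈ U, Finsupp.single u 1 : V →₀ ℕ) v = 0 := by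
      rw [Finsupp.add_apply, mem_support_notMem_vars_zero hKu hP, sum_single_one_apply, if_neg hvU]
    rw [show K + Finsupp.single w 1 + ∑ u ∈ U, Finsupp.single u 1 + Finsupp.single u 1 =
      K + Finsupp.single u 1 + ∑ u ∈ U, Finsupp.single u 1 + Finsupp.single w 1 by abel,
      mem_support_iff, add_comm (C (a w) * X v), coeff_add_single_linear_mul hvw.symm _ _ hdeg]
    exact mul_ne_zero hbw
      (mem_support_iff.1 (add_sum_single_mem_support_prod_linear_mul hP hvU hb hKu))
  · exact ⟨v, .inl rfl, mem_support_iff.2 hv⟩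

theorem coeff_add_mul_of_isHomogeneous {P Q : MvPolynomial V R} {n : ℕ} (hQ : Q.IsHomogeneous n)
    {N₁ N₂ : V →₀ ℕ} (hdeg : N₂.degree = n) (hdisj : ∀ z ∈ P.vars, N₂ z = 0) :
    coeff (N₁ + N₂) (P * Q) = coeff N₁ P * coeff N₂ Q := by
  classical
  rw [coeff_mul]
  refine Finset.sum_eq_single (N₁, N₂) ?_ (by simp)
  rintro ⟨M₁, M₂⟩ hM hne
  rw [Finset.HasAntidiagonal.mem_antidiagonal] at hM
  by_contra h0
  have hM₁ : M₁ ∈ P.support := mem_support_iff.2 (left_ne_zero_of_mul h0)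
  have hle : N₂ ≤ M₂ := by
    intro z
    have hz : M₁ z + M₂ z = N₁ z + N₂ z := by simpa using DFunLike.congr_fun hM z
    by_cases hzP : z ∈ P.vars
    · simp [hdisj z hzP]
    · have := mem_support_notMem_vars_zero hM₁ hzP
      omega
  obtain ⟨K, rfl⟩ := exists_add_of_le hle
  have hdegK : (N₂ + K).degree = N₂.degree := by
    rw [hdeg, Finsupp.degree_eq_weight_one]
    exact hQ (right_ne_zero_of_mul h0)
  rw [map_add, Nat.add_eq_left, Finsupp.degree_eq_zero_iff] at hdegK
  subst hdegK
  rw [add_zero] at hM hne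
  exact hne (Prod.ext (add_right_cancel hM) rfl)

/-- `L` attaches to every edge `ij` of `G` a linear form `a x_i + b x_j` with `a, b ≠ 0`; its
values outside the edge set of `G` are irrelevant. -/
def IsEdgeForm (G : SimpleGraph V) (L : Sym2 V → MvPolynomial V R) : Prop :=
  ∀ i j, G.Adj i j → ∃ a b : R, a ≠ 0 ∧ b ≠ 0 ∧ L s(i, j) = C a * X i + C b * X j

namespace IsEdgeForm

variable {G : SimpleGraph V} {L : Sym2 V → MvPolynomial V R} {E E₁ E₂ : Finset (Sym2 V)}

theorem isHomogeneous_prod (hL : IsEdgeForm G L) (hE : ∀ e ∈ E, e ∈ G.edgeSet) :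
    (∏ e ∈ E, L e).IsHomogeneous E.card := by
  rw [Finset.card_eq_sum_ones]
  refine IsHomogeneous.prod _ _ _ fun e he => ?_
  induction e with | _ i j
  obtain ⟨a, b, -, -, h⟩ := hL i j (hE _ he)
  rw [h]
  exact (isHomogeneous_C_mul_X a i).add (isHomogeneous_C_mul_X b j)

theorem exists_mem_of_mem_vars_prod (hL : IsEdgeForm G L) (hE : ∀ e ∈ E, e ∈ G.edgeSet) {z : V}
    (hz : z ∈ (∏ e ∈ E, L e).vars) : ∃ e ∈ E, z ∈ e := by
  classical
  obtain ⟨e, he, hze⟩ := Finset.mem_biUnion.1 (vars_prod L hz)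
  refine ⟨e, he, ?_⟩
  induction e with | _ i j
  obtain ⟨a, b, -, -, h⟩ := hL i j (hE _ he)
  have mem_vars_C_mul_X {c : R} {k : V} (hk : z ∈ (C c * X k).vars) : z = k := by
    have : Nontrivial R := by
      by_contra h
      have := not_nontrivial_iff_subsingleton.1 h
      simp [Subsingleton.elim c 0] at hk
    simpa using vars_mul _ _ hk
  rw [h] at hze
  simpa using (Finset.mem_union.1 (vars_add_subset _ _ hze)).imp mem_vars_C_mul_X mem_vars_C_mul_X

theorem notMem_vars_prod (hL : IsEdgeForm G L) (hE : ∀ e ∈ E, e ∈ G.edgeSet) {z : V}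
    (hz : ∀ e ∈ E, z ∉ e) : z ∉ (∏ e ∈ E, L e).vars := fun h =>
  let ⟨e, he, hze⟩ := hL.exists_mem_of_mem_vars_prod hE h
  hz e he hze

theorem eq_zero_of_mem_support_prod (hL : IsEdgeForm G L) (hE : ∀ e ∈ E, e ∈ G.edgeSet)
    {N : V →₀ ℕ} (hN : N ∈ (∏ e ∈ E, L e).support) {z : V} (hz : ∀ e ∈ E, z ∉ e) : N z = 0 :=
  mem_support_notMem_vars_zero hN (hL.notMem_vars_prod hE hz)

theorem exists_mem_support_prod_star_union [NoZeroDivisors R] [DecidableEq V]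
    (hL : IsEdgeForm G L) {v w x : V} {U : Finset V} (hvx : G.Adj v x) (hvw : G.Adj v w)
    (hvU : ∀ u ∈ U, G.Adj v u) (hxw : x ≠ w) (hxU : x ∉ U) (hwU : w ∉ U)
    (hE : ∀ e ∈ E, e ∈ G.edgeSet) (hv : ∀ e ∈ E, v ∉ e) {N : V →₀ ℕ}
    (hN : N ∈ (∏ e ∈ E, L e).support) (hNx : N x = 0) :
    ∃ t, (t = v ∨ t ∈ U) ∧
      N + ∑ u ∈ U, Finsupp.single u 1 + Finsupp.single t 1 + Finsupp.single v 1 ∈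
        (∏ e ∈ (insert x (insert w U)).image (fun u => s(v, u)) ∪ E, L e).support := by
  choose! a b hab using hL v
  have hvU' : v ∉ U := fun h => (hvU v h).ne rfl
  have hdisj : Disjoint ((insert x (insert w U)).image fun u => s(v, u)) E := by
    refine Finset.disjoint_left.2 fun e he hE => hv e hE ?_
    obtain ⟨u, -, rfl⟩ := Finset.mem_image.1 he
    exact Sym2.mem_mk_left v u
  have hprod : ∏ e ∈ (insert x (insert w U)).image (fun u => s(v, u)) ∪ E, L e =
      (C (a x) * X v + C (b x) * X x) * ((C (a w) * X v + C (b w) * X w) *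
        ((∏ u ∈ U, (C (a u) * X v + C (b u) * X u)) * ∏ e ∈ E, L e)) := by
    rw [Finset.prod_union hdisj, Finset.prod_image fun _ _ _ _ h => Sym2.congr_right.1 h,
      Finset.prod_insert (by simp [hxw, hxU]), Finset.prod_insert hwU, (hab x hvx).2.2,
      (hab w hvw).2.2, Finset.prod_congr rfl fun u hu => (hab u (hvU u hu)).2.2, mul_assoc,
      mul_assoc]
  obtain ⟨t, ht, hmem⟩ := exists_add_single_mem_support_star_mul hvw.ne hvU' hwU (hab w hvw).1
    (hab w hvw).2.1 (fun u hu => (hab u (hvU u hu)).2.1) (hL.notMem_vars_prod hE hv) hN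
  have hxt : t ≠ x := by
    rintro rfl
    exact ht.elim hvx.ne' hxU
  refine ⟨t, ht, ?_⟩
  rw [hprod, mem_support_iff, coeff_add_single_linear_mul hvx.ne]
  · exact mul_ne_zero (hab x hvx).1 (mem_support_iff.1 hmem)
  · rw [Finsupp.add_apply, Finsupp.add_apply, sum_single_one_apply, if_neg hxU, hNx,
      Finsupp.single_eq_of_ne hxt.symm, add_zero, add_zero]

theorem add_mem_support_prod_union [NoZeroDivisors R] [DecidableEq (Sym2 V)] (hL : IsEdgeForm G L)
    (hE₁ : ∀ e ∈ E₁, e ∈ G.edgeSet) (hE₂ : ∀ e ∈ E₂, e ∈ G.edgeSet) (hdisj : Disjoint E₁ E₂)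
    {N₁ N₂ : V →₀ ℕ} (h₁ : N₁ ∈ (∏ e ∈ E₁, L e).support) (h₂ : N₂ ∈ (∏ e ∈ E₂, L e).support)
    (h : ∀ e ∈ E₁, ∀ z ∈ e, N₂ z = 0) : N₁ + N₂ ∈ (∏ e ∈ E₁ ∪ E₂, L e).support := by
  have hdeg : N₂.degree = E₂.card := by
    rw [Finsupp.degree_eq_weight_one]
    exact hL.isHomogeneous_prod hE₂ (mem_support_iff.1 h₂)
  rw [Finset.prod_union hdisj, mem_support_iff,
    coeff_add_mul_of_isHomogeneous (hL.isHomogeneous_prod hE₂) hdeg]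
  · exact mul_ne_zero (mem_support_iff.1 h₁) (mem_support_iff.1 h₂)
  · intro z hz
    obtain ⟨e, he, hze⟩ := hL.exists_mem_of_mem_vars_prod hE₁ hz
    exact h e he z hze

end IsEdgeForm

end Polynomials

section ConsecutivePairs

variable {α : Type*} {a b c i j k : α} {l m : List α}

theorem pair_infix_cons_cons : [i, j] <:+: a :: b :: l ↔ (i = a ∧ j = b) ∨ [i, j] <:+: b :: l := by
  simp [List.infix_cons_iff (l₂ := b :: l)]

theorem not_pair_infix_singleton : ¬ [i, j] <:+: [a] := fun h => by simpa using h.length_le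

theorem pair_infix_append_cons :
    [i, j] <:+: l ++ a :: m ↔ [i, j] <:+: l ++ [a] ∨ [i, j] <:+: a :: m := by
  induction l with
  | nil => simp [not_pair_infix_singleton]
  | cons b l ih =>
    cases l with
    | nil => simp [pair_infix_cons_cons, not_pair_infix_singleton]
    | cons c l => simpa [pair_infix_cons_cons, or_assoc] using or_congr_right ih

theorem mem_of_pair_infix_cons (h : [i, j] <:+: a :: l) : j ∈ l := by
  obtain h | h := List.infix_cons_iff.1 h
  · obtain ⟨-, h⟩ := List.cons_prefix_cons.1 h
    exact h.subset (by simp)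
  · exact h.subset (by simp)

theorem exists_pair_infix_cons_of_mem (h : j ∈ l) : ∃ i, [i, j] <:+: a :: l := by
  induction l generalizing a with
  | nil => simp at h
  | cons b l ih =>
    obtain rfl | h := List.mem_cons.1 h
    · exact ⟨a, pair_infix_cons_cons.2 (.inl ⟨rfl, rfl⟩)⟩
    · exact (ih h).imp fun i hi => pair_infix_cons_cons.2 (.inr hi)

theorem eq_of_pair_infix_cons (hl : l.Nodup) (hi : [i, k] <:+: a :: l) (hj : [j, k] <:+: a :: l) :
    i = j := by
  induction l generalizing a with
  | nil => exact (not_pair_infix_singleton hi).elim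
  | cons b l ih =>
    obtain ⟨hb, hl⟩ := List.nodup_cons.1 hl
    obtain ⟨rfl, hk⟩ | hi' := pair_infix_cons_cons.1 hi <;>
      obtain ⟨rfl, hk'⟩ | hj' := pair_infix_cons_cons.1 hj
    · rfl
    · exact (hb (hk ▸ mem_of_pair_infix_cons hj')).elim
    · exact (hb (hk' ▸ mem_of_pair_infix_cons hi')).elim
    · exact ih hl hi' hj'

theorem mem_of_triple_infix_cons_append_singleton (h : [i, j, k] <:+: a :: (l ++ [b])) :
    j ∈ l := by
  induction l generalizing a with
  | nil => simpa using h.length_le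
  | cons c l ih =>
    obtain h | h := List.infix_cons_iff.1 h
    · simp_all
    · exact List.mem_cons_of_mem _ (ih h)

theorem iff_of_pair_infix_cons_cons {P : α → α → Prop}
    (h : ∀ i j k, [i, j, k] <:+: a :: b :: l → (P i j ↔ P j k)) (hij : [i, j] <:+: a :: b :: l) :
    P i j ↔ P a b := by
  induction l generalizing a b with
  | nil => simp_all [pair_infix_cons_cons, not_pair_infix_singleton]
  | cons c l ih =>
    obtain ⟨rfl, rfl⟩ | hij := pair_infix_cons_cons.1 hij
    · rfl
    · rw [ih (fun i j k hijk => h i j k (List.infix_cons hijk)) hij, h a b c ⟨[], l, rfl⟩]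

end ConsecutivePairs

namespace RotationSystem

variable {V : Type*} {G : SimpleGraph V} (R : RotationSystem G)

/-- The face to the left of a dart. -/
def face (d : G.Dart) : R.Face := Quotient.mk (Equiv.Perm.SameCycle.setoid R.facePerm) d

theorem exists_face_eq (f : R.Face) : ∃ d, R.face d = f := Quotient.exists_rep f

theorem fst_facePerm (d : G.Dart) : (R.facePerm d).fst = d.snd := R.fst_next d.symm

theorem face_facePerm (d : G.Dart) : R.face (R.facePerm d) = R.face d :=
  Quotient.sound (Equiv.Perm.sameCycle_apply_left.2 (Equiv.Perm.SameCycle.refl _ _))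

theorem face_next (d : G.Dart) : R.face (R.next d) = R.face d.symm :=
  R.face_facePerm d.symm

theorem finite_dart [Finite V] : Finite G.Dart :=
  Finite.of_injective _ SimpleGraph.Dart.toProd_injective

instance finite_face [Finite V] : Finite R.Face :=
  have : Finite G.Dart := finite_dart
  Quotient.finite _

theorem of_next [Finite V] {P : G.Dart → Prop} (h : ∀ d, P d → P (R.next d)) {d d' : G.Dart}
    (hd : P d) (hdd : d.fst = d'.fst) : P d' := by
  have : Finite G.Dart := finite_dart
  obtain ⟨n, -, -, rfl⟩ := (R.sameCycle_of_fst_eq d d' hdd).exists_pow_eq'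
  clear hdd
  induction n with
  | zero => exact hd
  | succ n ih => exact pow_succ' R.next n ▸ h _ ih

theorem apply_face_eq_of_apply_face_symm_eq [Finite V] (hG : G.Connected) {α : Type*}
    {f : R.Face → α} (hf : ∀ d : G.Dart, f (R.face d) = f (R.face d.symm)) (i j : R.Face) :
    f i = f j := by
  have at_vertex (d d' : G.Dart) (h : d.fst = d'.fst) : f (R.face d) = f (R.face d') :=
    R.of_next (P := fun e => f (R.face d) = f (R.face e))
      (fun e he => by rw [he, R.face_next, hf e]) rfl h
  obtain ⟨d, rfl⟩ := R.exists_face_eq i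
  obtain ⟨d', rfl⟩ := R.exists_face_eq j
  obtain ⟨w⟩ := hG.preconnected d.fst d'.fst
  generalize ha : d.fst = a at w
  generalize hb : d'.fst = b at w
  induction w generalizing d with
  | nil => exact at_vertex d d' (ha.trans hb.symm)
  | cons hadj _ ih =>
    rw [at_vertex d ⟨(_, _), hadj⟩ ha, hf]
    exact ih _ rfl hb

/-- The face to the left of the dart `(a, b)` belongs to the set of faces `S`. -/
def Left (S : Set R.Face) (a b : V) : Prop := ∃ h : G.Adj a b, R.face ⟨(a, b), h⟩ ∈ S

/-- The dart `(a, b)` runs along the boundary of the set of faces `S`, which lies on its left side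
only. -/
def Bd (S : Set R.Face) (a b : V) : Prop := R.Left S a b ∧ ¬ R.Left S b a

/-- The vertices of the faces in `S`. -/
def vertices (S : Set R.Face) : Set V := {z | ∃ b, R.Left S z b}

open Classical in
/-- The edges of the faces in `S`. -/
noncomputable def edges [Fintype V] (S : Set R.Face) : Finset (Sym2 V) :=
  Finset.univ.filter fun e => ∃ d : G.Dart, R.face d ∈ S ∧ d.edge = e

section Regions

variable {R} {S A : Set R.Face} {a b c d z : V}

theorem Left.adj (h : R.Left S a b) : G.Adj a b := h.1

theorem left_iff (h : G.Adj a b) : R.Left S a b ↔ R.face ⟨(a, b), h⟩ ∈ S :=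
  ⟨fun ⟨_, h⟩ => h, fun h' => ⟨h, h'⟩⟩

theorem left_dart_iff (d : G.Dart) : R.Left S d.fst d.snd ↔ R.face d ∈ S := left_iff d.adj

theorem left_compl_iff (h : G.Adj a b) : R.Left Sᶜ a b ↔ ¬ R.Left S a b := by
  simp [left_iff h]

theorem left_diff_iff : R.Left (S \ A) a b ↔ R.Left S a b ∧ ¬ R.Left A a b := by
  by_cases h : G.Adj a b
  · simp [left_iff h]
  · simp [Left, h]

theorem Left.mono (hAS : A ⊆ S) (h : R.Left A a b) : R.Left S a b := ⟨h.1, hAS h.2⟩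

theorem Left.exists_left (h : R.Left S a b) : ∃ c, R.Left S b c := by
  have hmem : R.face (R.facePerm ⟨(a, b), h.1⟩) ∈ S := by rw [face_facePerm]; exact h.2
  exact ⟨_, R.fst_facePerm ⟨(a, b), h.1⟩ ▸ (left_dart_iff _).2 hmem⟩

theorem Left.symm_or_bd (h : R.Left S a b) : R.Left S b a ∨ R.Bd S a b :=
  (em _).imp_right fun h' => ⟨h, h'⟩

theorem bd_compl_iff : R.Bd Sᶜ a b ↔ R.Bd S b a := by
  by_cases h : G.Adj a b
  · simp [Bd, left_compl_iff h, left_compl_iff h.symm, and_comm]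
  · exact iff_of_false (fun h' => h h'.1.adj) fun h' => h h'.1.adj.symm

theorem bd_diff_iff (hAS : A ⊆ S) :
    R.Bd (S \ A) a b ↔ (R.Bd S a b ∧ ¬ R.Left A a b) ∨ (R.Bd A b a ∧ R.Left S a b) := by
  have := fun h : R.Left A b a => h.mono hAS
  simp only [Bd, left_diff_iff]
  tauto

theorem left_next_iff {z : V} (d : G.Dart) (hd : d.fst = z) :
    R.Left S z (R.next d).snd ↔ R.Left S d.snd z := by
  subst hd
  rw [← R.fst_next d, left_dart_iff, face_next, R.fst_next d]
  exact (left_dart_iff d.symm).symm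

theorem Left.of_forall_not_bd [Finite V] (hz : ∀ d, ¬ R.Bd S z d) (hb : R.Left S z b)
    (hc : G.Adj z c) : R.Left S z c := by
  refine (left_iff hc).2 (R.of_next (P := fun e => e.fst = z ∧ R.face e ∈ S) ?_
    (d := ⟨(z, b), hb.1⟩) (d' := ⟨(z, c), hc⟩) ⟨rfl, hb.2⟩ rfl).2
  rintro e ⟨rfl, he⟩
  refine ⟨R.fst_next e, ?_⟩
  have hsymm := ((left_dart_iff e).2 he).symm_or_bd.resolve_right (hz _)
  rw [face_next]
  exact (left_dart_iff e.symm).1 hsymm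

theorem eq_univ_of_forall_not_bd [Finite V] (hG : G.Connected) (h : ∀ a b, ¬ R.Bd S a b)
    (hS : S.Nonempty) : S = Set.univ := by
  obtain ⟨i, hi⟩ := hS
  refine Set.eq_univ_of_forall fun j => ?_
  refine (R.apply_face_eq_of_apply_face_symm_eq hG (f := (· ∈ S)) (fun e => ?_) i j).mp hi
  refine propext ⟨fun he => ?_, fun he => ?_⟩
  · exact (left_dart_iff e.symm).1 (((left_dart_iff e).2 he).symm_or_bd.resolve_right (h _ _))
  · exact (left_dart_iff e).1 (((left_dart_iff e.symm).2 he).symm_or_bd.resolve_right (h _ _))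

theorem ncard_left_out_eq (S : Set R.Face) (z : V) :
    {b | R.Left S z b}.ncard = {b | R.Left S b z}.ncard := by
  refine (Set.ncard_congr (fun b hb => (R.next ⟨(z, b), hb.adj.symm⟩).snd) ?_ ?_ ?_).symm
  · exact fun b hb => (left_next_iff ⟨(z, b), hb.adj.symm⟩ rfl).2 hb
  · intro b c hb hc hbc
    have := R.next.injective (SimpleGraph.Dart.ext _ _ (Prod.ext
      ((R.fst_next ⟨(z, b), hb.adj.symm⟩).trans (R.fst_next ⟨(z, c), hc.adj.symm⟩).symm) hbc))
    exact congrArg (·.snd) this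
  · intro c hc
    obtain ⟨⟨⟨x, b⟩, hb⟩, hd⟩ := R.next.surjective ⟨(z, c), hc.adj⟩
    obtain rfl : x = z := by simpa [hd] using (R.fst_next ⟨(x, b), hb⟩).symm
    have hbz : R.Left S b x := (left_next_iff ⟨(x, b), hb⟩ rfl).1 (by rwa [hd])
    exact ⟨b, hbz, congrArg (·.snd) hd⟩

variable [Finite V]

theorem ncard_bd_out_eq (S : Set R.Face) (z : V) :
    {b | R.Bd S z b}.ncard = {b | R.Bd S b z}.ncard := by
  have hout := Set.ncard_sdiff_add_ncard {b | R.Left S z b} {b | R.Left S b z}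
    (Set.toFinite _) (Set.toFinite _)
  have hin := Set.ncard_sdiff_add_ncard {b | R.Left S b z} {b | R.Left S z b}
    (Set.toFinite _) (Set.toFinite _)
  rw [Set.union_comm, ← hout, ncard_left_out_eq, Nat.add_right_cancel_iff] at hin
  exact hin.symm

theorem Bd.exists_out (h : R.Bd S b z) : ∃ c, R.Bd S z c := by
  have hpos : 0 < {b | R.Bd S b z}.ncard := (Set.ncard_pos (Set.toFinite _)).2 ⟨b, h⟩
  rw [← ncard_bd_out_eq] at hpos
  exact (Set.ncard_pos (Set.toFinite _)).1 hpos

theorem Bd.exists_in (h : R.Bd S z b) : ∃ c, R.Bd S c z := by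
  obtain ⟨c, hc⟩ := (bd_compl_iff.2 h).exists_out
  exact ⟨c, bd_compl_iff.1 hc⟩

theorem Bd.eq_of_in_unique (h : ∀ b, R.Bd S b z → b = a) (hc : R.Bd S z c) (hd : R.Bd S z d) :
    c = d := by
  have hout : {b | R.Bd S z b}.ncard ≤ 1 := by
    rw [ncard_bd_out_eq]
    exact (Set.ncard_le_one (Set.toFinite _)).2 fun x hx y hy => (h x hx).trans (h y hy).symm
  exact (Set.ncard_le_one (Set.toFinite _)).1 hout c hc d hd

theorem exists_bd_of_mem_vertices_of_disjoint (hSA : Disjoint S A) (hS : z ∈ R.vertices S)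
    (hA : z ∈ R.vertices A) : ∃ b, R.Bd S z b := by
  obtain ⟨b, hb⟩ := hS
  obtain ⟨c, hc⟩ := hA
  by_contra! h
  exact Set.disjoint_left.1 hSA (hb.of_forall_not_bd h hc.adj).2 hc.2

end Regions

section Edges

variable {R} [Fintype V] {S A : Set R.Face} {a b z : V} {e : Sym2 V}

theorem mem_edges : e ∈ R.edges S ↔ ∃ d : G.Dart, R.face d ∈ S ∧ d.edge = e := by simp [edges]

theorem mk_mem_edges : s(a, b) ∈ R.edges S ↔ R.Left S a b ∨ R.Left S b a := by
  rw [mem_edges]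
  constructor
  · rintro ⟨⟨⟨i, j⟩, hij⟩, hd, he⟩
    obtain ⟨rfl, rfl⟩ | ⟨rfl, rfl⟩ := Sym2.eq_iff.1 he
    · exact .inl ⟨hij, hd⟩
    · exact .inr ⟨hij, hd⟩
  · rintro (h | h)
    · exact ⟨_, h.2, rfl⟩
    · exact ⟨_, h.2, Sym2.eq_swap⟩

theorem mem_edgeSet_of_mem_edges (he : e ∈ R.edges S) : e ∈ G.edgeSet := by
  obtain ⟨d, -, rfl⟩ := mem_edges.1 he
  exact d.edge_mem

theorem mem_vertices_of_mem_edges (he : e ∈ R.edges S) (hz : z ∈ e) : z ∈ R.vertices S := by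
  obtain ⟨b, rfl⟩ := Sym2.mem_iff_exists.1 hz
  obtain h | h := mk_mem_edges.1 he
  · exact ⟨b, h⟩
  · exact h.exists_left

theorem edges_diff_union_edges [DecidableEq V] (hAS : A ⊆ S) :
    R.edges (S \ A) ∪ R.edges A = R.edges S := by
  ext e
  simp only [Finset.mem_union, mem_edges, ← exists_or, ← or_and_right, ← Set.mem_union,
    Set.sdiff_union_of_subset hAS]

end Edges

end RotationSystem

namespace RotationSystem

section Homology

open Module

variable {V : Type*} [Fintype V] [DecidableEq V] {G : SimpleGraph V}

theorem finrank_le_one_of_const {K ι : Type*} [Field K] (W : Submodule K (ι → K))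
    (h : ∀ f ∈ W, ∀ i j, f i = f j) : finrank K W ≤ 1 := by
  have hW : W ≤ Submodule.span K {1} := by
    intro f hf
    rw [Submodule.mem_span_singleton]
    obtain hι | ⟨⟨i⟩⟩ := isEmpty_or_nonempty ι
    · exact ⟨0, Subsingleton.elim _ _⟩
    · exact ⟨f i, by ext j; simp [h f hf i j]⟩
  calc finrank K W ≤ finrank K (Submodule.span K {(1 : ι → K)}) := Submodule.finrank_mono hW
    _ ≤ 1 := by simpa using finrank_span_le_card (R := K) {(1 : ι → K)}

/-- The vertex-edge incidence matrix modulo two, whose columns are the edges of `G` only. -/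
def incidence (G : SimpleGraph V) : Matrix V G.edgeSet (ZMod 2) :=
  Matrix.of fun v e => if v ∈ e.1 then 1 else 0

theorem incidence_transpose_mulVec (φ : V → ZMod 2) {a b : V} (h : G.Adj a b) :
    (incidence G).transpose.mulVec φ ⟨s(a, b), h⟩ = φ a + φ b := by
  simp only [Matrix.mulVec, dotProduct, incidence, Matrix.transpose_apply, Matrix.of_apply,
    Sym2.mem_iff, ite_mul, one_mul, zero_mul]
  rw [← Finset.sum_pair h.ne, ← Finset.sum_filter]
  exact Finset.sum_congr (by ext; simp) fun _ _ => rfl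

theorem finrank_ker_incidence_transpose_le_one (hG : G.Connected) :
    finrank (ZMod 2) (LinearMap.ker (incidence G).transpose.mulVecLin) ≤ 1 := by
  refine finrank_le_one_of_const _ fun φ hφ a b => ?_
  have hφ' : (incidence G).transpose.mulVec φ = 0 := hφ
  obtain ⟨w⟩ := hG.preconnected a b
  induction w with
  | nil => rfl
  | cons hadj _ ih =>
    have hφadj := incidence_transpose_mulVec φ hadj
    rw [hφ'] at hφadj
    exact (CharTwo.add_eq_zero.1 hφadj.symm).trans ih

variable [DecidableRel G.Adj] (R : RotationSystem G)

/-- The boundary map modulo two: a set of faces, given by its indicator function, is sent to the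
edges that have an odd number of sides in it. -/
def faceBoundary : (R.Face → ZMod 2) →ₗ[ZMod 2] (G.edgeSet → ZMod 2) where
  toFun f e := ∑ d : G.Dart, if d.edge = e.1 then f (R.face d) else 0
  map_add' f g := by
    ext e
    simp only [Pi.add_apply, ← Finset.sum_add_distrib]
    exact Finset.sum_congr rfl fun d _ => by split_ifs <;> simp
  map_smul' c f := by
    ext e
    simp only [Pi.smul_apply, smul_eq_mul, Finset.mul_sum, RingHom.id_apply]
    exact Finset.sum_congr rfl fun d _ => by split_ifs <;> simp

theorem faceBoundary_edge (f : R.Face → ZMod 2) (d : G.Dart) :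
    R.faceBoundary f ⟨d.edge, d.edge_mem⟩ = f (R.face d) + f (R.face d.symm) := by
  change ∑ d' : G.Dart, (if d'.edge = d.edge then f (R.face d') else 0) = _
  simp only [SimpleGraph.dart_edge_eq_iff]
  rw [← Finset.sum_pair (f := fun d => f (R.face d)) d.symm_ne.symm, ← Finset.sum_filter]
  exact Finset.sum_congr (by ext; simp) fun _ _ => rfl

theorem incidence_mulVec_faceBoundary_apply (f : R.Face → ZMod 2) (v : V) :
    (incidence G).mulVec (R.faceBoundary f) v =
      ∑ d : G.Dart, if v ∈ d.edge then f (R.face d) else 0 := by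
  simp only [Matrix.mulVec, dotProduct, incidence, Matrix.of_apply, faceBoundary,
    LinearMap.coe_mk, AddHom.coe_mk, Finset.mul_sum]
  rw [Finset.sum_comm]
  refine Finset.sum_congr rfl fun d _ => ?_
  rw [Finset.sum_eq_single ⟨d.edge, d.edge_mem⟩]
  · simp
  · intro e _ he
    rw [if_neg (c := d.edge = e.1) fun h => he (Subtype.ext h.symm), mul_zero]
  · simp

theorem incidence_mulVec_faceBoundary (f : R.Face → ZMod 2) :
    (incidence G).mulVec (R.faceBoundary f) = 0 := by
  ext v
  have hsplit : ∀ d : G.Dart, (if v ∈ d.edge then f (R.face d) else 0) =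
      (if d.fst = v then f (R.face d) else 0) + (if d.snd = v then f (R.face d) else 0) := by
    intro d
    have hne := d.fst_ne_snd
    simp only [show d.edge = s(d.fst, d.snd) from rfl, Sym2.mem_iff, eq_comm (a := v)]
    by_cases h : d.fst = v
    · subst h; simp [hne.symm]
    · simp [h]
  have hsnd : ∑ d : G.Dart, (if d.snd = v then f (R.face d) else 0) =
      ∑ d : G.Dart, if d.fst = v then f (R.face d.symm) else 0 :=
    (Equiv.sum_comp (Function.Involutive.toPerm SimpleGraph.Dart.symm
      SimpleGraph.Dart.symm_involutive)
      (fun d : G.Dart => if d.snd = v then f (R.face d) else 0)).symm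
  have hfst : ∑ d : G.Dart, (if d.fst = v then f (R.face d) else 0) =
      ∑ d : G.Dart, if d.fst = v then f (R.face d.symm) else 0 := by
    rw [← Equiv.sum_comp R.next]
    simp only [R.fst_next, R.face_next]
  rw [incidence_mulVec_faceBoundary_apply, Finset.sum_congr rfl fun d _ => hsplit d,
    Finset.sum_add_distrib, hsnd, hfst]
  exact CharTwo.add_self_eq_zero _

variable {R}

theorem finrank_ker_faceBoundary_le_one (hG : G.Connected) :
    finrank (ZMod 2) (LinearMap.ker R.faceBoundary) ≤ 1 := by
  refine finrank_le_one_of_const _ fun f hf =>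
    R.apply_face_eq_of_apply_face_symm_eq hG fun d => ?_
  have hd := R.faceBoundary_edge f d
  rw [LinearMap.mem_ker.1 hf] at hd
  exact CharTwo.add_eq_zero.1 hd.symm

theorem range_faceBoundary (hR : R.IsPlane) :
    LinearMap.range R.faceBoundary = LinearMap.ker (incidence G).mulVecLin := by
  obtain ⟨hconn, heuler⟩ := hR
  have : Fintype R.Face := Fintype.ofFinite _
  refine Submodule.eq_of_le_of_finrank_le ?_ ?_
  · rintro _ ⟨f, rfl⟩
    exact R.incidence_mulVec_faceBoundary f
  have hkerB := finrank_ker_faceBoundary_le_one (R := R) hconn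
  have hkerT := finrank_ker_incidence_transpose_le_one hconn
  have hB := LinearMap.finrank_range_add_finrank_ker R.faceBoundary
  have hI := LinearMap.finrank_range_add_finrank_ker (incidence G).mulVecLin
  have hT := LinearMap.finrank_range_add_finrank_ker (incidence G).transpose.mulVecLin
  have hrank : finrank (ZMod 2) (LinearMap.range (incidence G).mulVecLin) =
      finrank (ZMod 2) (LinearMap.range (incidence G).transpose.mulVecLin) :=
    (Matrix.rank_transpose (incidence G)).symm
  rw [finrank_fintype_fun_eq_card, ← Nat.card_eq_fintype_card] at hB hI hT
  omega

theorem incidence_mulVec_edges_eq_zero {a : V} {w : G.Walk a a} (hw : w.IsTrail) :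
    (incidence G).mulVec (fun e => if e.1 ∈ w.edges then 1 else 0) = 0 := by
  ext v
  have hcard : (Finset.univ.filter fun e : G.edgeSet => v ∈ e.1 ∧ e.1 ∈ w.edges).card =
      w.edges.countP fun e => v ∈ e := by
    rw [List.countP_eq_length_filter, ← List.toFinset_card_of_nodup (hw.edges_nodup.filter _)]
    refine Finset.card_bij (fun e _ => e.1) ?_ (fun _ _ _ _ h => Subtype.ext h) ?_
    · intro e he
      simpa [and_comm] using he
    · intro e he
      have he' : e ∈ w.edges ∧ v ∈ e := by simpa using he
      exact ⟨⟨e, w.edges_subset_edgeSet he'.1⟩, by simpa [and_comm] using he', rfl⟩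
  have heven : Even (w.edges.countP fun e => v ∈ e) := by
    simpa using hw.even_countP_edges_iff v
  simp only [Matrix.mulVec, dotProduct, incidence, Matrix.of_apply, ite_mul, one_mul, zero_mul,
    ← ite_and, Finset.sum_boole, hcard, Pi.zero_apply]
  exact (ZMod.natCast_eq_zero_iff_even).2 heven

end Homology

theorem exists_bd_iff_mem_edges_of_isTrail {V : Type*} [Fintype V] {G : SimpleGraph V}
    {R : RotationSystem G} (hR : R.IsPlane) {a : V} {w : G.Walk a a} (hw : w.IsTrail) :
    ∃ S : Set R.Face, ∀ i j, R.Bd S i j ∨ R.Bd S j i ↔ s(i, j) ∈ w.edges := by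
  classical
  have hmem : (fun e : G.edgeSet => if e.1 ∈ w.edges then 1 else 0) ∈
      LinearMap.range R.faceBoundary :=
    range_faceBoundary hR ▸ incidence_mulVec_edges_eq_zero hw
  obtain ⟨f, hf⟩ := hmem
  refine ⟨{i | f i = 1}, fun i j => ?_⟩
  by_cases h : G.Adj i j
  · have hij := R.faceBoundary_edge f ⟨(i, j), h⟩
    have odd_iff : ∀ x y : ZMod 2, x + y ≠ 0 ↔ x = 1 ∧ ¬ y = 1 ∨ y = 1 ∧ ¬ x = 1 := by decide
    rw [Bd, Bd, left_iff h, left_iff h.symm]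
    refine (odd_iff _ _).symm.trans ?_
    rw [show (⟨(j, i), h.symm⟩ : G.Dart) = SimpleGraph.Dart.symm ⟨(i, j), h⟩ from rfl, ← hij, hf]
    by_cases h' : s(i, j) ∈ w.edges <;> simp [SimpleGraph.Dart.edge, h']
  · exact iff_of_false (fun h' => h'.elim (fun h' => h h'.1.adj) fun h' => h h'.1.adj.symm)
      fun h' => h (w.edges_subset_edgeSet h')

end RotationSystem

namespace RotationSystem

variable {V : Type*} {G : SimpleGraph V} {R : RotationSystem G}

section Triangles

variable {S : Set R.Face} {f : R.Face} {a b c i j : V} {e : Sym2 V}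

variable (R) in
/-- The face `f` is the triangle `abc`, with the darts `(a, b)`, `(b, c)` and `(c, a)`. -/
def IsTriangle (f : R.Face) (a b c : V) : Prop :=
  ∀ i j, R.Left {f} i j ↔ (i = a ∧ j = b) ∨ (i = b ∧ j = c) ∨ (i = c ∧ j = a)

theorem face_eq_iff_of_facePerm_pow_three {d d' : G.Dart}
    (hd : R.facePerm (R.facePerm (R.facePerm d)) = d) :
    R.face d' = R.face d ↔
      d' = d ∨ d' = R.facePerm d ∨ d' = R.facePerm (R.facePerm d) := by
  constructor
  · intro h
    obtain ⟨n, hn⟩ := (Quotient.exact h.symm : R.facePerm.SameCycle d d')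
    have hpow : (R.facePerm ^ (3 : ℤ)) d = d := hd
    rw [← Int.emod_add_mul_ediv n 3, zpow_add, zpow_mul, Equiv.Perm.mul_apply,
      Equiv.Perm.zpow_apply_eq_self_of_apply_eq_self hpow] at hn
    obtain h | h | h : n % 3 = 0 ∨ n % 3 = 1 ∨ n % 3 = 2 := by lia
    · exact .inl (by simpa [h] using hn.symm)
    · exact .inr (.inl (by simpa [h] using hn.symm))
    · exact .inr (.inr (by rw [← hn, h]; rfl))
  · rintro (rfl | rfl | rfl) <;> simp only [face_facePerm]

theorem Left.exists_isTriangle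
    (hR : ∀ d : G.Dart, R.facePerm (R.facePerm (R.facePerm d)) = d) (h : R.Left S a b) :
    ∃ f ∈ S, ∃ c, R.IsTriangle f a b c := by
  obtain ⟨hab, hS⟩ := h
  set d : G.Dart := ⟨(a, b), hab⟩
  set c := (R.facePerm d).toProd.2
  have hd : d.toProd = (a, b) := rfl
  have hbc : (R.facePerm d).toProd = (b, c) := Prod.ext (R.fst_facePerm d) rfl
  have hca : (R.facePerm (R.facePerm d)).toProd = (c, a) :=
    Prod.ext (R.fst_facePerm _) ((R.fst_facePerm _).symm.trans (by rw [hR d]))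
  refine ⟨_, hS, c, fun i j => ?_⟩
  by_cases hij : G.Adj i j
  · rw [left_iff hij, Set.mem_singleton_iff, face_eq_iff_of_facePerm_pow_three (hR d)]
    simp only [SimpleGraph.Dart.ext_iff, hd, hbc, hca, Prod.mk.injEq]
  · refine iff_of_false (fun h => hij h.adj) ?_
    rintro (⟨rfl, rfl⟩ | ⟨rfl, rfl⟩ | ⟨rfl, rfl⟩)
    · exact hij hab
    · exact hij (by simpa only [hbc] using (R.facePerm d).adj)
    · exact hij (by simpa only [hca] using (R.facePerm (R.facePerm d)).adj)

namespace IsTriangle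

theorem rotate (hf : R.IsTriangle f a b c) : R.IsTriangle f b c a := fun i j => by
  rw [hf]; tauto

theorem ne (hf : R.IsTriangle f a b c) : a ≠ b :=
  ((hf a b).2 (.inl ⟨rfl, rfl⟩)).adj.ne

theorem left (hf : R.IsTriangle f a b c) (hfS : f ∈ S) : R.Left S a b :=
  ((hf a b).2 (.inl ⟨rfl, rfl⟩)).mono (Set.singleton_subset_iff.2 hfS)

theorem bd_diff_iff (hf : R.IsTriangle f a b c) (hfS : f ∈ S) :
    R.Bd (S \ {f}) i j ↔
      (R.Bd S i j ∧ ¬ ((i = a ∧ j = b) ∨ (i = b ∧ j = c) ∨ (i = c ∧ j = a))) ∨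
        (((j = a ∧ i = b) ∨ (j = b ∧ i = c) ∨ (j = c ∧ i = a)) ∧ R.Left S i j) := by
  have hab := hf.ne
  have hbc := hf.rotate.ne
  have hca := hf.rotate.rotate.ne
  rw [RotationSystem.bd_diff_iff (Set.singleton_subset_iff.2 hfS), Bd, Bd, hf i j, hf j i]
  grind

theorem mem_edges_diff_singleton_iff [Fintype V] (hf : R.IsTriangle f a b c) (hfS : f ∈ S) :
    e ∈ R.edges S ↔ e ∈ R.edges (S \ {f}) ∨ e = s(a, b) ∨ e = s(b, c) ∨ e = s(c, a) := by
  have h₁ := hf.left hfS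
  have h₂ := hf.rotate.left hfS
  have h₃ := hf.rotate.rotate.left hfS
  induction e with | _ i j
  simp only [mk_mem_edges, left_diff_iff, hf i j, hf j i, Sym2.eq_iff]
  grind

end IsTriangle

end Triangles

section Disks

variable {S : Set R.Face} {f : R.Face} {a b c u v w x y : V} {l m p : List V} {e : Sym2 V}

variable (R) in
/-- The set of faces `S` is a combinatorial disk: its boundary is the simple closed curve through
the vertices of the list `p`, in this order, with `S` on the left. The last vertex of `p` is `y`,
so that the darts of the curve are the pairs of consecutive entries of `y :: p`. -/
structure IsDisk (S : Set R.Face) (y : V) (p : List V) : Prop where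
  nodup : p.Nodup
  getLast?_eq : p.getLast? = some y
  bd_iff : ∀ a b, R.Bd S a b ↔ [a, b] <:+: y :: p

namespace IsDisk

theorem mem_of_bd_right (h : R.IsDisk S y p) (hab : R.Bd S a b) : b ∈ p :=
  mem_of_pair_infix_cons ((h.bd_iff a b).1 hab)

theorem mem_of_bd_left [Finite V] (h : R.IsDisk S y p) (hab : R.Bd S a b) : a ∈ p :=
  let ⟨_, hc⟩ := hab.exists_in
  h.mem_of_bd_right hc

theorem exists_bd (h : R.IsDisk S y p) (hb : b ∈ p) : ∃ a, R.Bd S a b :=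
  (exists_pair_infix_cons_of_mem hb).imp fun a => (h.bd_iff a b).2

theorem mem_vertices (h : R.IsDisk S y p) (hb : b ∈ p) : b ∈ R.vertices S :=
  let ⟨_, ha⟩ := h.exists_bd hb
  ha.1.exists_left

theorem bd_left_unique (h : R.IsDisk S y p) (ha : R.Bd S a c) (hb : R.Bd S b c) : a = b :=
  eq_of_pair_infix_cons h.nodup ((h.bd_iff _ _).1 ha) ((h.bd_iff _ _).1 hb)

theorem bd_right_unique [Finite V] (h : R.IsDisk S y p) (ha : R.Bd S c a) (hb : R.Bd S c b) :
    a = b :=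
  let ⟨_, hd⟩ := ha.exists_in
  Bd.eq_of_in_unique (fun _ hb => h.bd_left_unique hb hd) ha hb

theorem rotate (h : R.IsDisk S y (l ++ a :: (m ++ [y]))) :
    R.IsDisk S a (m ++ y :: (l ++ [a])) := by
  refine ⟨?_, by simp [List.getLast?_cons], fun i j => ?_⟩
  · refine (List.Perm.nodup_iff ?_).1 h.nodup
    simpa using (List.perm_append_comm (l₁ := l ++ [a]) (l₂ := m ++ [y]))
  · have hleft := pair_infix_append_cons (i := i) (j := j) (l := y :: l) (a := a) (m := m ++ [y])
    have hright := pair_infix_append_cons (i := i) (j := j) (l := a :: m) (a := y) (m := l ++ [a])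
    simp only [List.cons_append] at hleft hright
    rw [h.bd_iff, hleft, hright, or_comm]

theorem diff_triangle_of_notMem [Finite V] (h : R.IsDisk S y (x :: v :: w :: l))
    (hf : R.IsTriangle f v w u) (hfS : f ∈ S) (hu : u ∉ x :: v :: w :: l) :
    R.IsDisk (S \ {f}) y (x :: v :: u :: w :: l) := by
  have hvw : R.Bd S v w := by simp [h.bd_iff, pair_infix_cons_cons]
  have huw : R.Left S u w := ((hf.rotate.left hfS).symm_or_bd).resolve_right
    fun hb => hu (h.mem_of_bd_right hb)
  have hvu : R.Left S v u := ((hf.rotate.rotate.left hfS).symm_or_bd).resolve_right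
    fun hb => hu (h.mem_of_bd_left hb)
  have hnodup := h.nodup
  refine ⟨?_, by simpa using h.getLast?_eq, fun i j => ?_⟩
  · simp only [List.nodup_cons, List.mem_cons] at hnodup hu ⊢
    grind
  · have hbd := h.bd_iff i j
    have hu₁ : R.Bd S i j → i ≠ u := by
      rintro hb rfl
      exact hu (h.mem_of_bd_left hb)
    have hu₂ : R.Bd S i j → j ≠ u := by
      rintro hb rfl
      exact hu (h.mem_of_bd_right hb)
    have hl : [i, j] <:+: w :: l → j ∈ l := mem_of_pair_infix_cons
    rw [hf.bd_diff_iff hfS]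
    simp only [pair_infix_cons_cons, List.nodup_cons, List.mem_cons] at hnodup hbd hu ⊢
    grind [Bd]

theorem mem_edges_iff_of_notMem [Fintype V] (h : R.IsDisk S y (x :: v :: w :: l))
    (hf : R.IsTriangle f v w u) (hfS : f ∈ S) (hu : u ∉ x :: v :: w :: l) :
    e ∈ R.edges S ↔ e ∈ R.edges (S \ {f}) ∨ e = s(v, w) := by
  have hdiff := h.diff_triangle_of_notMem hf hfS hu
  have hvu := ((hdiff.bd_iff v u).2 (by simp [pair_infix_cons_cons])).1
  have huw := ((hdiff.bd_iff u w).2 (by simp [pair_infix_cons_cons])).1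
  rw [hf.mem_edges_diff_singleton_iff hfS]
  refine ⟨?_, fun h => h.imp_right .inl⟩
  rintro (h | h | rfl | rfl)
  · exact .inl h
  · exact .inr h
  · exact .inl (mk_mem_edges.2 (.inr huw))
  · exact .inl (mk_mem_edges.2 (.inr hvu))

theorem diff_triangle_of_left (h : R.IsDisk S y (x :: v :: w :: l))
    (hf : R.IsTriangle f v w x) (hfS : f ∈ S) (hxw : R.Left S x w) :
    R.IsDisk (S \ {f}) y (x :: w :: l) := by
  have hnodup := h.nodup
  have hvw : R.Bd S v w := by simp [h.bd_iff, pair_infix_cons_cons]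
  have hxv : R.Bd S x v := by simp [h.bd_iff, pair_infix_cons_cons]
  refine ⟨hnodup.sublist (by simp), by simpa using h.getLast?_eq, fun i j => ?_⟩
  have hbd := h.bd_iff i j
  have hl : [i, j] <:+: w :: l → j ∈ l := mem_of_pair_infix_cons
  rw [hf.bd_diff_iff hfS]
  simp only [pair_infix_cons_cons, List.nodup_cons, List.mem_cons] at hnodup hbd ⊢
  grind [Bd]

theorem notMem_vertices_diff_triangle [Finite V] (h : R.IsDisk S y (x :: v :: w :: l))
    (hf : R.IsTriangle f v w x) (hfS : f ∈ S) (hxw : R.Left S x w) :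
    v ∉ R.vertices (S \ {f}) := by
  rintro ⟨b, hb⟩
  have hxv : R.Bd S x v := by simp [h.bd_iff, pair_infix_cons_cons]
  have hv : v ∉ x :: w :: l := by
    have := h.nodup
    simp only [List.nodup_cons, List.mem_cons] at this ⊢
    grind
  have hvx := hb.of_forall_not_bd
    (fun _ hd => hv ((h.diff_triangle_of_left hf hfS hxw).mem_of_bd_left hd)) hxv.1.adj.symm
  exact hxv.2 (hvx.mono Set.sdiff_subset)

theorem eq_singleton_of_isTriangle [Finite V] (hG : G.Connected) (h : R.IsDisk S y [x, v, y])
    (hf : R.IsTriangle f v y x) (hfS : f ∈ S) : S = {f} := by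
  have hnot_bd (i j : V) : ¬ R.Bd (S \ {f}) i j := by
    have hij := h.bd_iff i j
    have hji := h.bd_iff j i
    simp only [pair_infix_cons_cons, not_pair_infix_singleton] at hij hji
    rw [hf.bd_diff_iff hfS]
    grind [Bd]
  refine Set.Subset.antisymm (Set.sdiff_eq_empty.1 ?_) (Set.singleton_subset_iff.2 hfS)
  by_contra hne
  have huniv := eq_univ_of_forall_not_bd hG hnot_bd (Set.nonempty_iff_ne_empty.2 hne)
  exact (huniv ▸ Set.mem_univ f : f ∈ S \ {f}).2 rfl

theorem eq_nil_of_bd (h : R.IsDisk S y (x :: v :: w :: l)) (hwx : R.Bd S w x) :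
    w = y ∧ l = [] := by
  have hyx : R.Bd S y x := by simp [h.bd_iff, pair_infix_cons_cons]
  obtain rfl : w = y := h.bd_left_unique hwx hyx
  refine ⟨rfl, ?_⟩
  cases l with
  | nil => rfl
  | cons a l =>
    have hmem : w ∈ a :: l := List.mem_of_getLast? (by simpa using h.getLast?_eq)
    have := h.nodup
    simp_all

theorem exists_remove_last_triangle [Fintype V] (hG : G.Connected)
    (h : R.IsDisk S y (x :: v :: w :: l)) (hf : R.IsTriangle f v w x) (hfS : f ∈ S) :
    (S \ {f} = ∅ ∨ R.IsDisk (S \ {f}) y (x :: w :: l)) ∧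
      (∀ e ≠ s(x, y), e ∈ R.edges S ↔ e ∈ R.edges (S \ {f}) ∨ e = s(v, x) ∨ e = s(v, w)) ∧
      v ∉ R.vertices (S \ {f}) := by
  have hedges (e : Sym2 V) := hf.mem_edges_diff_singleton_iff (e := e) hfS
  rw [Sym2.eq_swap (a := x)] at hedges
  by_cases hxw : R.Left S x w
  · have hdisk := h.diff_triangle_of_left hf hfS hxw
    have hmem : s(x, w) ∈ R.edges (S \ {f}) :=
      mk_mem_edges.2 (.inl ((hdisk.bd_iff x w).2 (by simp [pair_infix_cons_cons])).1)
    refine ⟨.inr hdisk, fun e _ => ?_, h.notMem_vertices_diff_triangle hf hfS hxw⟩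
    rw [Sym2.eq_swap (a := x)] at hmem
    grind
  · obtain ⟨rfl, rfl⟩ := h.eq_nil_of_bd ⟨hf.rotate.left hfS, hxw⟩
    obtain rfl := h.eq_singleton_of_isTriangle hG hf hfS
    refine ⟨.inl Set.sdiff_self, fun e he => ?_, by simp [vertices, Left]⟩
    rw [hedges]
    grind [Sym2.eq_swap]

theorem exists_remove_star [Fintype V] (hG : G.Connected)
    (hR : ∀ d : G.Dart, R.facePerm (R.facePerm (R.facePerm d)) = d)
    (h : R.IsDisk S y (x :: v :: w :: l))
    (hchord : ∀ c ∈ x :: v :: w :: l, R.Left S v c → ¬ R.Left S c v) :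
    ∃ (us : List V) (S' : Set R.Face), S' ⊂ S ∧
      (S' = ∅ ∨ R.IsDisk S' y (x :: (us ++ w :: l))) ∧
      (∀ u ∈ us, u ∉ x :: v :: w :: l) ∧
      (∀ e ≠ s(x, y), e ∈ R.edges S ↔ e ∈ R.edges S' ∨ ∃ z ∈ x :: w :: us, e = s(v, z)) ∧
      v ∉ R.vertices S' := by
  induction hn : S.ncard using Nat.strong_induction_on generalizing S w l with | _ n ih
  have hvw : R.Bd S v w := by simp [h.bd_iff, pair_infix_cons_cons]
  have hxv : R.Bd S x v := by simp [h.bd_iff, pair_infix_cons_cons]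
  obtain ⟨f, hfS, u, hf⟩ := hvw.1.exists_isTriangle hR
  have hss : S \ {f} ⊂ S := Set.sdiff_singleton_ssubset.2 hfS
  obtain rfl | hux := eq_or_ne u x
  · obtain ⟨hdisk, hedges, hv⟩ := h.exists_remove_last_triangle hG hf hfS
    exact ⟨[], _, hss, hdisk, by simp, by simpa using hedges, hv⟩
  have huv : R.Left S u v := hf.rotate.rotate.left hfS
  have hu : u ∉ x :: v :: w :: l := fun hu =>
    hux (h.bd_left_unique ⟨huv, fun hvu => hchord u hu hvu huv⟩ hxv)
  have huv' : ¬ R.Left (S \ {f}) u v := fun h' =>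
    (left_diff_iff.1 h').2 ((hf u v).2 (by simp))
  have hdiff := h.diff_triangle_of_notMem hf hfS hu
  obtain ⟨us, S', hS', hdisk, hus, hedges, hv⟩ := ih _ (hn ▸ Set.ncard_lt_ncard hss) hdiff
    (fun c hc hvc hcv => by
      by_cases hcu : c = u
      · exact huv' (hcu ▸ hcv)
      · exact hchord c (by grind) (hvc.mono Set.sdiff_subset) (hcv.mono Set.sdiff_subset)) rfl
  refine ⟨us ++ [u], S', hS'.trans hss, by simpa using hdisk, by grind, fun e he => ?_, hv⟩
  rw [h.mem_edges_iff_of_notMem hf hfS hu, hedges e he]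
  simp only [List.mem_cons, List.mem_append, List.not_mem_nil, or_false, or_and_right, exists_or,
    exists_eq_left]
  simp only [or_comm, or_left_comm]

end IsDisk

end Disks

end RotationSystem

namespace RotationSystem

variable {V : Type*} {G : SimpleGraph V} {R : RotationSystem G}

section Chords

variable {S A : Set R.Face} {a b c v w x y i j k : V} {l l₁ l₂ : List V}

theorem exists_walk_support_eq (h : ∀ i j, [i, j] <:+: a :: (l ++ [b]) → G.Adj i j) :
    ∃ p : G.Walk a b, p.support = a :: (l ++ [b]) := by
  induction l generalizing a with
  | nil => exact ⟨(h a b (by simp)).toWalk, by simp⟩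
  | cons d l ih =>
    obtain ⟨p, hp⟩ := ih fun i j hij => h i j (hij.trans (List.suffix_cons _ _).isInfix)
    exact ⟨.cons (h a d (by simp [pair_infix_cons_cons])) p, by simp [hp]⟩

/-- The region `A` is cut off from `S` by a chord: its boundary consists of the dart `(c, v)` and of
the boundary darts of `S` that have `A` on their left. -/
structure IsCutOff (S A : Set R.Face) (c v : V) : Prop where
  subset : A ⊆ S
  bd_iff : ∀ i j, R.Bd A i j ↔ (i = c ∧ j = v) ∨ (R.Bd S i j ∧ R.Left A i j)

theorem exists_isTrail_of_arc (harc : ∀ i j, [i, j] <:+: v :: (l ++ [c]) → R.Bd S i j)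
    (hl : (v :: (l ++ [c])).Nodup) (hvc : R.Left S v c) (hcv : R.Left S c v) :
    ∃ t : G.Walk c c, t.IsTrail ∧ s(c, v) ∈ t.edges ∧
      ∀ i j, s(i, j) ∈ t.edges → s(i, j) = s(c, v) ∨ R.Bd S i j ∨ R.Bd S j i := by
  obtain ⟨p, hp⟩ := exists_walk_support_eq fun i j hij => (harc i j hij).1.adj
  have hbd (i j : V) (hij : s(i, j) ∈ p.edges) : R.Bd S i j ∨ R.Bd S j i := by
    rw [← SimpleGraph.Walk.infix_support_iff_mem_edges, hp] at hij
    exact hij.imp (harc i j) (harc j i)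
  refine ⟨.cons hcv.adj p, ?_, by simp, fun i j hij => ?_⟩
  · refine (SimpleGraph.Walk.isTrail_cons _ _).2
      ⟨(SimpleGraph.Walk.IsPath.mk' (hp ▸ hl)).isTrail, fun h => ?_⟩
    exact (hbd c v h).elim (·.2 hvc) (·.2 hcv)
  · rw [SimpleGraph.Walk.edges_cons, List.mem_cons] at hij
    exact hij.imp_right (hbd i j)

theorem exists_bd_and_bd_iff_mem_edges [Fintype V] (hR : R.IsPlane) {t : G.Walk a a}
    (ht : t.IsTrail) (hcv : s(c, v) ∈ t.edges) :
    ∃ B : Set R.Face, R.Bd B c v ∧ ∀ i j, R.Bd B i j ∨ R.Bd B j i ↔ s(i, j) ∈ t.edges := by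
  obtain ⟨B, hB⟩ := exists_bd_iff_mem_edges_of_isTrail hR ht
  obtain h | h := (hB c v).2 hcv
  · exact ⟨B, h, hB⟩
  · exact ⟨Bᶜ, bd_compl_iff.2 h, fun i j => by rw [bd_compl_iff, bd_compl_iff, or_comm, hB]⟩

theorem exists_isCutOff [Fintype V] (hR : R.IsPlane)
    (harc : ∀ i j, [i, j] <:+: v :: (l ++ [c]) → R.Bd S i j)
    (hl : (v :: (l ++ [c])).Nodup) (hvc : R.Left S v c) (hcv : R.Left S c v) :
    ∃ A, IsCutOff S A c v := by
  obtain ⟨t, ht, hcvt, htS⟩ := exists_isTrail_of_arc harc hl hvc hcv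
  obtain ⟨B, hB, hBt⟩ := exists_bd_and_bd_iff_mem_edges hR ht hcvt
  refine ⟨S ∩ B, Set.inter_subset_left, fun i j => ?_⟩
  by_cases hij : G.Adj i j
  swap
  · refine iff_of_false (fun h => hij h.1.adj) ?_
    rintro (⟨rfl, rfl⟩ | ⟨h, -⟩)
    · exact hij hcv.adj
    · exact hij h.1.adj
  have hinter {i j : V} : R.Left (S ∩ B) i j ↔ R.Left S i j ∧ R.Left B i j :=
    ⟨fun h => ⟨⟨h.1, h.2.1⟩, ⟨h.1, h.2.2⟩⟩, fun h => ⟨h.1.1, h.1.2, h.2.2⟩⟩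
  simp only [Bd, hinter]
  constructor
  · rintro ⟨⟨hSij, hBij⟩, hji⟩
    by_cases hSji : R.Left S j i
    · have hBd : R.Bd B i j := ⟨hBij, fun h => hji ⟨hSji, h⟩⟩
      obtain h | h | h := htS i j ((hBt i j).1 (.inl hBd))
      · obtain h | ⟨rfl, rfl⟩ := Sym2.eq_iff.1 h
        · exact .inl h
        · exact (hB.2 hBij).elim
      · exact (h.2 hSji).elim
      · exact (h.2 hSij).elim
    · exact .inr ⟨⟨hSij, hSji⟩, hSij, hBij⟩
  · rintro (⟨rfl, rfl⟩ | ⟨h, hA⟩)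
    · exact ⟨⟨hcv, hB.1⟩, fun h => hB.2 h.2⟩
    · exact ⟨hA, fun h' => h.2 h'.1⟩

theorem IsDisk.bd_iff_arcs (h : R.IsDisk S v (l₁ ++ c :: (l₂ ++ [v]))) (i j : V) :
    R.Bd S i j ↔ [i, j] <:+: v :: (l₁ ++ [c]) ∨ [i, j] <:+: c :: (l₂ ++ [v]) := by
  rw [h.bd_iff, ← List.cons_append, pair_infix_append_cons, List.cons_append]

namespace IsCutOff

variable [Finite V]

theorem left_iff_left (hA : IsCutOff S A c v)
    (hin : ∀ {i j k}, R.Bd S i k → R.Bd S j k → i = j) (hij : R.Bd S i j) (hjk : R.Bd S j k)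
    (hjc : j ≠ c) (hjv : j ≠ v) : R.Left A i j ↔ R.Left A j k := by
  constructor <;> intro h
  · obtain ⟨m, hm⟩ := ((hA.bd_iff i j).2 (.inr ⟨hij, h⟩)).exists_out
    obtain ⟨hSm, hAm⟩ := ((hA.bd_iff j m).1 hm).resolve_left fun h => hjc h.1
    rwa [Bd.eq_of_in_unique (fun b hb => hin hb hij) hjk hSm]
  · obtain ⟨m, hm⟩ := ((hA.bd_iff j k).2 (.inr ⟨hjk, h⟩)).exists_in
    obtain ⟨hSm, hAm⟩ := ((hA.bd_iff m j).1 hm).resolve_left fun h => hjv h.2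
    rwa [hin hij hSm]

theorem left_iff_left_of_arc (hA : IsCutOff S A c v)
    (hin : ∀ {i j k}, R.Bd S i k → R.Bd S j k → i = j)
    (harc : ∀ i j, [i, j] <:+: a :: (l ++ [b]) → R.Bd S i j) (hcl : c ∉ l) (hvl : v ∉ l) :
    ∃ d, R.Bd S a d ∧ ∀ i j, [i, j] <:+: a :: (l ++ [b]) → (R.Left A i j ↔ R.Left A a d) := by
  have hstep (i j k : V) (h : [i, j, k] <:+: a :: (l ++ [b])) : R.Left A i j ↔ R.Left A j k := by
    have hj := mem_of_triple_infix_cons_append_singleton h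
    have hij : [i, j] <:+: [i, j, k] := (List.prefix_append [i, j] [k]).isInfix
    have hjk : [j, k] <:+: [i, j, k] := (List.suffix_cons i [j, k]).isInfix
    exact hA.left_iff_left hin (harc i j (hij.trans h)) (harc j k (hjk.trans h))
      (ne_of_mem_of_not_mem hj hcl) (ne_of_mem_of_not_mem hj hvl)
  obtain ⟨d, m, hd⟩ : ∃ d m, l ++ [b] = d :: m := List.exists_cons_of_ne_nil (by simp)
  rw [hd] at harc hstep ⊢
  refine ⟨d, harc a d (by simp [pair_infix_cons_cons]), fun i j => ?_⟩
  exact iff_of_pair_infix_cons_cons hstep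

theorem left_iff_pair_infix (hA : IsCutOff S A c v) (h : R.IsDisk S v (l₁ ++ c :: (l₂ ++ [v])))
    (hvc : R.Left S v c) (hij : R.Bd S i j) : R.Left A i j ↔ [i, j] <:+: v :: (l₁ ++ [c]) := by
  have hbd := h.bd_iff_arcs
  have hnodup := h.nodup
  simp only [List.nodup_append, List.nodup_cons, List.mem_append, List.mem_cons] at hnodup
  have hcvA : R.Bd A c v := (hA.bd_iff c v).2 (.inl ⟨rfl, rfl⟩)
  obtain ⟨d, hd, hd_iff⟩ := hA.left_iff_left_of_arc h.bd_left_unique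
    (fun i j h => (hbd i j).2 (.inl h)) (by grind) (by grind)
  obtain ⟨e, he, he_iff⟩ := hA.left_iff_left_of_arc h.bd_left_unique
    (fun i j h => (hbd i j).2 (.inr h)) (by grind) (by grind)
  have hdA : R.Left A v d := by
    obtain ⟨m, hm⟩ := hcvA.exists_out
    obtain ⟨hSm, hAm⟩ := ((hA.bd_iff v m).1 hm).resolve_left fun h => hvc.adj.ne h.1
    rwa [h.bd_right_unique hd hSm]
  have heA : ¬ R.Left A c e := fun heA => by
    obtain ⟨m, hm⟩ := hcvA.exists_in
    have bd_of_bd {b : V} (hb : R.Bd A b c) : R.Bd S b c :=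
      (((hA.bd_iff b c).1 hb).resolve_left fun h => hvc.adj.ne h.2.symm).1
    have hev : e = v := Bd.eq_of_in_unique
      (fun b hb => h.bd_left_unique (bd_of_bd hb) (bd_of_bd hm))
      ((hA.bd_iff c e).2 (.inr ⟨he, heA⟩)) hcvA
    exact he.2 (hev ▸ hvc)
  refine ⟨fun hij' => ?_, fun hij' => (hd_iff i j hij').2 hdA⟩
  exact ((hbd i j).1 hij).resolve_right fun h => heA ((he_iff i j h).1 hij')

theorem isDisk (hA : IsCutOff S A c v) (h : R.IsDisk S v (l₁ ++ c :: (l₂ ++ [v])))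
    (hvc : R.Left S v c) : R.IsDisk A v (l₁ ++ c :: [v]) := by
  refine ⟨h.nodup.sublist (by simp), by simp, fun i j => ?_⟩
  have hbd := h.bd_iff_arcs i j
  have hsplit := pair_infix_append_cons (i := i) (j := j) (l := v :: l₁) (a := c) (m := [v])
  rw [hA.bd_iff, and_congr_right (hA.left_iff_pair_infix h hvc), or_comm]
  refine Iff.trans ?_ (hsplit.trans (or_congr_right pair_infix_cons_cons)).symm
  simp only [not_pair_infix_singleton, or_false]
  exact or_congr_left (and_iff_right_of_imp fun h => hbd.2 (.inl h))

theorem isDisk_diff (hA : IsCutOff S A c v) (h : R.IsDisk S v (l₁ ++ c :: (l₂ ++ [v])))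
    (hvc : R.Left S v c) : R.IsDisk (S \ A) v (c :: (l₂ ++ [v])) := by
  refine ⟨h.nodup.sublist (List.sublist_append_right _ _), by simp [List.getLast?_cons],
    fun i j => ?_⟩
  have hbd := h.bd_iff_arcs i j
  rw [bd_diff_iff hA.subset, hA.bd_iff, pair_infix_cons_cons]
  have hij := hA.left_iff_pair_infix (i := i) (j := j) h hvc
  have hdisj (h₁ : [i, j] <:+: v :: (l₁ ++ [c])) : ¬ [i, j] <:+: c :: (l₂ ++ [v]) := fun h₂ => by
    have hnodup := h.nodup
    rw [List.append_cons, List.nodup_append'] at hnodup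
    exact hnodup.2.2 (mem_of_pair_infix_cons h₁) (mem_of_pair_infix_cons h₂)
  have hS : R.Bd S j i → ¬ R.Left S i j := And.right
  grind

end IsCutOff

theorem IsDisk.exists_split_of_chord [Fintype V] (hR : R.IsPlane)
    (h : R.IsDisk S y (x :: v :: w :: (l₁ ++ c :: l₂))) (hvc : R.Left S v c)
    (hcv : R.Left S c v) :
    ∃ A ⊂ S, S \ A ⊂ S ∧ R.IsDisk A c (v :: w :: (l₁ ++ [c])) ∧
      R.IsDisk (S \ A) y (x :: v :: c :: l₂) := by
  obtain ⟨m, hm⟩ : ∃ m, c :: l₂ = m ++ [y] :=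
    List.getLast?_eq_some_iff.1 (by simpa [List.getLast?_cons] using h.getLast?_eq)
  rw [hm] at h
  have hv : R.IsDisk S v ((w :: l₁) ++ c :: ((l₂ ++ [x]) ++ [v])) := by
    have hrot := congrArg (· ++ [x, v]) hm
    simp only [List.cons_append, List.append_assoc, List.nil_append] at hrot ⊢
    rw [hrot]
    simpa using rotate (l := [x]) (m := w :: (l₁ ++ m)) (by simpa using h)
  have harc (i j : V) : [i, j] <:+: v :: (w :: l₁ ++ [c]) → R.Bd S i j :=
    fun hij => (hv.bd_iff_arcs i j).2 (.inl hij)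
  have hnodup : (v :: (w :: l₁ ++ [c])).Nodup := by
    have := hv.nodup
    simp only [List.nodup_append, List.nodup_cons, List.mem_append, List.mem_cons] at this ⊢
    grind
  obtain ⟨A, hA⟩ := exists_isCutOff hR harc hnodup hvc hcv
  have hbd : R.Bd A c v := (hA.bd_iff c v).2 (.inl ⟨rfl, rfl⟩)
  refine ⟨A, hA.subset.ssubset_of_ne ?_, hA.subset.sdiff_ssubset_of_nonempty ⟨_, hbd.1.2⟩, ?_, ?_⟩
  · rintro rfl
    exact hbd.2 hvc
  · exact rotate (l := w :: l₁) (m := []) (hA.isDisk hv hvc)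
  · have := hA.isDisk_diff hv hvc
    rw [List.append_assoc, ← List.cons_append, hm] at this
    simpa [hm] using rotate (l := m) (a := y) (m := [x]) (by simpa using this)

end Chords

end RotationSystem

namespace RotationSystem

section Monomials

open MvPolynomial

variable {V : Type*} {G : SimpleGraph V} {R : RotationSystem G}
  {S S' A : Set R.Face} {c v w x y z : V} {l l₁ l₂ p us : List V} {N N₁ N₂ : V →₀ ℕ}
  {K : Type*} [CommSemiring K] {L : Sym2 V → MvPolynomial V K}

/-- The bounds on the degrees of a monomial of the product over a disk with boundary `p`, where the
boundary edge `xy` is left out of the product. -/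
structure DegreeBound (x y : V) (p : List V) (N : V →₀ ℕ) : Prop where
  left : N x = 0
  right : N y = 0
  boundary : ∀ z ∈ p, N z ≤ 2
  le_four : ∀ z, N z ≤ 4

theorem DegreeBound.zero (x y : V) (p : List V) : DegreeBound x y p 0 := by
  constructor <;> simp

section Chord

variable (hS : R.IsDisk S y (x :: v :: w :: (l₁ ++ c :: l₂)))
  (hA : R.IsDisk A c (v :: w :: (l₁ ++ [c]))) (hB : R.IsDisk (S \ A) y (x :: v :: c :: l₂))

include hS hA hB

theorem eq_or_eq_of_mem_vertices_of_chord [Finite V] (hzA : z ∈ R.vertices A)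
    (hzB : z ∈ R.vertices (S \ A)) : z = v ∨ z = c := by
  obtain ⟨_, hbA⟩ := exists_bd_of_mem_vertices_of_disjoint Set.disjoint_sdiff_right hzA hzB
  obtain ⟨_, hbB⟩ := exists_bd_of_mem_vertices_of_disjoint Set.disjoint_sdiff_left hzB hzA
  have hA' := hA.mem_of_bd_left hbA
  have hB' := hB.mem_of_bd_left hbB
  have := hS.nodup
  simp only [List.nodup_append, List.nodup_cons, List.mem_append, List.mem_cons] at this hA' hB'
  grind

theorem DegreeBound.add_of_chord [Finite V] (h₁ : DegreeBound v c (v :: w :: (l₁ ++ [c])) N₁)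
    (h₂ : DegreeBound x y (x :: v :: c :: l₂) N₂) (hN₁ : ∀ z ∈ R.vertices (S \ A), N₁ z = 0)
    (hN₂ : ∀ z ∉ R.vertices (S \ A), N₂ z = 0) :
    DegreeBound x y (x :: v :: w :: (l₁ ++ c :: l₂)) (N₂ + N₁) := by
  have hB₀ (z : V) (hz : z ∈ x :: v :: c :: l₂) : N₁ z = 0 := hN₁ z (hB.mem_vertices hz)
  have hy : y ∈ x :: v :: c :: l₂ := List.mem_of_getLast? hB.getLast?_eq
  refine ⟨by simp [h₂.left, hB₀ x], by simp [h₂.right, hB₀ y hy], fun z hz => ?_, fun z => ?_⟩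
  · rw [Finsupp.add_apply]
    by_cases hzB : z ∈ R.vertices (S \ A)
    · rw [hN₁ z hzB, add_zero]
      by_cases hz₂ : z ∈ x :: v :: c :: l₂
      · exact h₂.boundary z hz₂
      · have hzA : z ∈ v :: w :: (l₁ ++ [c]) := by grind
        obtain rfl | rfl :=
          eq_or_eq_of_mem_vertices_of_chord hS hA hB (hA.mem_vertices hzA) hzB <;>
          simp at hz₂
    · have hzA : z ∈ v :: w :: (l₁ ++ [c]) := by
        have := mt hB.mem_vertices hzB
        grind
      rw [hN₂ z hzB, zero_add]
      exact h₁.boundary z hzA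
  · rw [Finsupp.add_apply]
    by_cases hzB : z ∈ R.vertices (S \ A)
    · rw [hN₁ z hzB, add_zero]
      exact h₂.le_four z
    · rw [hN₂ z hzB, zero_add]
      exact h₁.le_four z

variable [Fintype V]

theorem edges_erase_eq_union_of_chord [DecidableEq V] (hAS : A ⊆ S) :
    (R.edges S).erase s(x, y) =
      (R.edges (S \ A)).erase s(x, y) ∪ (R.edges A).erase s(v, c) := by
  have hnodup := hS.nodup
  have hx : x ≠ v ∧ x ≠ c := by
    simp only [List.nodup_cons, List.mem_append, List.mem_cons] at hnodup
    grind
  have hxA : s(x, y) ∉ R.edges A := fun h => by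
    have := eq_or_eq_of_mem_vertices_of_chord hS hA hB
      (mem_vertices_of_mem_edges h (Sym2.mem_mk_left x y)) (hB.mem_vertices (by simp))
    tauto
  have hvcB : s(v, c) ∈ R.edges (S \ A) :=
    mk_mem_edges.2 (.inl ((hB.bd_iff v c).2 (by simp [pair_infix_cons_cons])).1)
  have : s(v, c) ≠ s(x, y) := fun h => by
    have : x ∈ s(v, c) := h ▸ Sym2.mem_mk_left x y
    rw [Sym2.mem_iff] at this
    tauto
  rw [← edges_diff_union_edges hAS]
  ext e
  grind

theorem disjoint_edges_erase_of_chord [DecidableEq V] :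
    Disjoint ((R.edges (S \ A)).erase s(x, y)) ((R.edges A).erase s(v, c)) := by
  refine Finset.disjoint_left.2 fun e heB heA => ?_
  obtain ⟨hvc, heA⟩ := Finset.mem_erase.1 heA
  have heB := Finset.mem_of_mem_erase heB
  have hmem {z : V} (hz : z ∈ e) : z = v ∨ z = c :=
    eq_or_eq_of_mem_vertices_of_chord hS hA hB (mem_vertices_of_mem_edges heA hz)
      (mem_vertices_of_mem_edges heB hz)
  have hadj := mem_edgeSet_of_mem_edges heA
  induction e with | _ i j
  have := hadj.ne
  obtain rfl | rfl := hmem (Sym2.mem_mk_left i j) <;>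
    obtain rfl | rfl := hmem (Sym2.mem_mk_right _ j) <;>
    simp_all [Sym2.eq_swap]

theorem exists_mem_support_prod_of_chord [DecidableEq V] [NoZeroDivisors K]
    (hL : IsEdgeForm G L) (hAS : A ⊆ S)
    (h₁ : ∃ N ∈ (∏ e ∈ (R.edges A).erase s(v, c), L e).support,
      DegreeBound v c (v :: w :: (l₁ ++ [c])) N)
    (h₂ : ∃ N ∈ (∏ e ∈ (R.edges (S \ A)).erase s(x, y), L e).support,
      DegreeBound x y (x :: v :: c :: l₂) N) :
    ∃ N ∈ (∏ e ∈ (R.edges S).erase s(x, y), L e).support,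
      DegreeBound x y (x :: v :: w :: (l₁ ++ c :: l₂)) N := by
  obtain ⟨N₁, hN₁, h₁⟩ := h₁
  obtain ⟨N₂, hN₂, h₂⟩ := h₂
  have hE (S : Set R.Face) (i j : V) (e : Sym2 V) (he : e ∈ (R.edges S).erase s(i, j)) :
      e ∈ G.edgeSet := mem_edgeSet_of_mem_edges (Finset.mem_of_mem_erase he)
  have hzero {S : Set R.Face} {i j : V} {N : V →₀ ℕ}
      (hN : N ∈ (∏ e ∈ (R.edges S).erase s(i, j), L e).support) (z : V)
      (hz : z ∉ R.vertices S) : N z = 0 :=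
    hL.eq_zero_of_mem_support_prod (hE S i j) hN fun e he hze =>
      hz (mem_vertices_of_mem_edges (Finset.mem_of_mem_erase he) hze)
  have hN₁B (z : V) (hzB : z ∈ R.vertices (S \ A)) : N₁ z = 0 := by
    by_cases hzA : z ∈ R.vertices A
    · obtain rfl | rfl := eq_or_eq_of_mem_vertices_of_chord hS hA hB hzA hzB
      · exact h₁.left
      · exact h₁.right
    · exact hzero hN₁ z hzA
  refine ⟨N₂ + N₁, ?_, h₁.add_of_chord hS hA hB h₂ hN₁B (hzero hN₂)⟩
  rw [edges_erase_eq_union_of_chord hS hA hB hAS]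
  exact hL.add_mem_support_prod_union (hE _ _ _) (hE _ _ _)
    (disjoint_edges_erase_of_chord hS hA hB) hN₂ hN₁ fun e he z hz =>
      hN₁B z (mem_vertices_of_mem_edges (Finset.mem_of_mem_erase he) hz)

end Chord

theorem DegreeBound.add_star [DecidableEq V] {t : V}
    (h : DegreeBound x y (x :: (us ++ w :: l)) N) (hNv : N v = 0)
    (hnodup : (x :: v :: w :: l).Nodup) (hy : y ∈ w :: l)
    (hus : ∀ u ∈ us, u ∉ x :: v :: w :: l) (ht : t = v ∨ t ∈ us.toFinset) :
    DegreeBound x y (x :: v :: w :: l)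
      (N + ∑ u ∈ us.toFinset, Finsupp.single u 1 + Finsupp.single t 1 + Finsupp.single v 1) := by
  have hx : x ≠ v ∧ x ∉ us := by grind
  have hy : y ≠ v ∧ y ∉ us := by grind
  have apply_eq (z : V) : (N + ∑ u ∈ us.toFinset, Finsupp.single u 1 + Finsupp.single t 1 +
      Finsupp.single v 1 : V →₀ ℕ) z =
      N z + (if z ∈ us then 1 else 0) + (if z = t then 1 else 0) + if z = v then 1 else 0 := by
    simp [Finsupp.single_apply, eq_comm]
  have := h.left
  have := h.right
  rw [List.mem_toFinset] at ht
  constructor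
  · grind
  · grind
  · intro z hz
    have := h.boundary z
    grind
  · intro z
    have := h.boundary z
    have := h.le_four z
    grind

theorem IsDisk.exists_mem_support_prod_of_star [Fintype V] [DecidableEq V] [NoZeroDivisors K]
    (hL : IsEdgeForm G L) (h : R.IsDisk S y (x :: v :: w :: l))
    (hus : ∀ u ∈ us, u ∉ x :: v :: w :: l)
    (hedges : ∀ e ≠ s(x, y), e ∈ R.edges S ↔ e ∈ R.edges S' ∨ ∃ z ∈ x :: w :: us, e = s(v, z))
    (hv : v ∉ R.vertices S')
    (hN : ∃ N ∈ (∏ e ∈ (R.edges S').erase s(x, y), L e).support,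
      DegreeBound x y (x :: (us ++ w :: l)) N) :
    ∃ N ∈ (∏ e ∈ (R.edges S).erase s(x, y), L e).support,
      DegreeBound x y (x :: v :: w :: l) N := by
  obtain ⟨N, hN, hdeg⟩ := hN
  have hnodup := h.nodup
  have hy : y ∈ w :: l := List.mem_of_getLast? (by simpa using h.getLast?_eq)
  have hxU : x ∉ us.toFinset := mt List.mem_toFinset.1 fun hx => hus x hx (by simp)
  have hwU : w ∉ us.toFinset := mt List.mem_toFinset.1 fun hw => hus w hw (by simp)
  have hvxy : ∀ z ∈ x :: w :: us, s(v, z) ≠ s(x, y) := by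
    grind [Sym2.eq_iff]
  have hadj (z : V) (hz : z ∈ x :: w :: us) : G.Adj v z :=
    mem_edgeSet_of_mem_edges ((hedges _ (hvxy z hz)).2 (.inr ⟨z, hz, rfl⟩))
  have herase : (R.edges S).erase s(x, y) =
      (insert x (insert w us.toFinset)).image (fun u => s(v, u)) ∪
        (R.edges S').erase s(x, y) := by
    ext e
    simp only [Finset.mem_erase, Finset.mem_union, Finset.mem_image, Finset.mem_insert,
      List.mem_toFinset]
    grind
  have hE (e : Sym2 V) (he : e ∈ (R.edges S').erase s(x, y)) : e ∈ G.edgeSet :=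
    mem_edgeSet_of_mem_edges (Finset.mem_of_mem_erase he)
  have hvE (e : Sym2 V) (he : e ∈ (R.edges S').erase s(x, y)) (hve : v ∈ e) : False :=
    hv (mem_vertices_of_mem_edges (Finset.mem_of_mem_erase he) hve)
  obtain ⟨t, ht, hmem⟩ := hL.exists_mem_support_prod_star_union (U := us.toFinset)
    (hadj x (by simp)) (hadj w (by simp)) (fun u hu => hadj u (by simp_all)) (by grind) hxU hwU hE
    hvE hN hdeg.left
  exact ⟨_, herase ▸ hmem,
    hdeg.add_star (hL.eq_zero_of_mem_support_prod hE hN hvE) hnodup hy hus ht⟩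

theorem IsDisk.exists_eq_cons_cons {q : List V} (h : R.IsDisk S y (x :: q)) :
    ∃ v w l, q = v :: w :: l := by
  match q with
  | v :: w :: l => exact ⟨v, w, l, rfl⟩
  | [] =>
    obtain rfl : x = y := by simpa using h.getLast?_eq
    exact ((h.bd_iff x x).2 (by simp)).1.adj.ne rfl |>.elim
  | [v] =>
    obtain rfl : v = y := by simpa using h.getLast?_eq
    have hvx := (h.bd_iff v x).2 (by simp [pair_infix_cons_cons])
    have hxv := (h.bd_iff x v).2 (by simp [pair_infix_cons_cons])
    exact (hvx.2 hxv.1).elim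

theorem IsDisk.exists_mem_support_prod [Fintype V] [DecidableEq V] [NoZeroDivisors K]
    [Nontrivial K] (hL : IsEdgeForm G L) (hR : R.IsPlaneTriangulation) {q : List V}
    (h : R.IsDisk S y (x :: q)) :
    ∃ N ∈ (∏ e ∈ (R.edges S).erase s(x, y), L e).support, DegreeBound x y (x :: q) N := by
  induction hn : S.ncard using Nat.strong_induction_on generalizing S x y q with | _ n ih
  obtain ⟨v, w, l, rfl⟩ := h.exists_eq_cons_cons
  by_cases hchord : ∃ c ∈ x :: v :: w :: l, R.Left S v c ∧ R.Left S c v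
  · obtain ⟨c, hc, hvc, hcv⟩ := hchord
    have hxv := ((h.bd_iff x v).2 (by simp [pair_infix_cons_cons])).2
    have hvw := ((h.bd_iff v w).2 (by simp [pair_infix_cons_cons])).2
    obtain ⟨l₁, l₂, rfl⟩ : ∃ l₁ l₂, l = l₁ ++ c :: l₂ := by
      have := hvc.adj.ne
      exact List.append_of_mem (by grind)
    obtain ⟨A, hA, hB, hdA, hdB⟩ := h.exists_split_of_chord hR.1 hvc hcv
    exact exists_mem_support_prod_of_chord h hdA hdB hL hA.subset
      (ih _ (hn ▸ Set.ncard_lt_ncard hA) hdA rfl) (ih _ (hn ▸ Set.ncard_lt_ncard hB) hdB rfl)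
  · push Not at hchord
    obtain ⟨us, S', hS', hempty | hdisk, hus, hedges, hv⟩ :=
      h.exists_remove_star hR.1.1 hR.2 hchord
    · refine h.exists_mem_support_prod_of_star hL hus hedges hv ⟨0, ?_, .zero _ _ _⟩
      have : R.edges S' = ∅ := by ext e; simp [mem_edges, hempty]
      simp [this]
    · exact h.exists_mem_support_prod_of_star hL hus hedges hv
        (ih _ (hn ▸ Set.ncard_lt_ncard hS') hdisk rfl)

end Monomials

end RotationSystem

theorem IsEdgeForm.exists_eqOn {V K : Type*} [CommSemiring K] [Nontrivial K] {H : SimpleGraph V}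
    {L : Sym2 V → MvPolynomial V K} (hL : IsEdgeForm H L) (G : SimpleGraph V) :
    ∃ L', IsEdgeForm G L' ∧ Set.EqOn L' L H.edgeSet := by
  classical
  refine ⟨fun e => if e ∈ H.edgeSet then L e else
    Sym2.lift ⟨fun i j => MvPolynomial.X i + MvPolynomial.X j, fun _ _ => add_comm _ _⟩ e,
    fun i j _ => ?_, fun e he => if_pos he⟩
  by_cases hij : s(i, j) ∈ H.edgeSet
  · simpa only [if_pos hij] using hL i j hij
  · exact ⟨1, 1, one_ne_zero, one_ne_zero, by
      simpa only [if_neg hij, map_one, one_mul] using Sym2.lift_mk ..⟩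

theorem EdgeDecoration.isEdgeForm {V F : Type*} [LinearOrder V] [Field F] {H : SimpleGraph V}
    (δ : EdgeDecoration H F) :
    IsEdgeForm H fun e => MvPolynomial.C (δ.a e) * MvPolynomial.X e.inf +
      MvPolynomial.C (δ.b e) * MvPolynomial.X e.sup := by
  intro i j hij
  have ha := δ.a_ne_zero s(i, j) hij
  have hb := δ.b_ne_zero s(i, j) hij
  obtain h | h := le_total i j
  · exact ⟨_, _, ha, hb, by simp [h]⟩
  · exact ⟨_, _, hb, ha, by simp [h, add_comm]⟩

namespace RotationSystem

variable {V : Type*} [Fintype V] {G : SimpleGraph V} {R : RotationSystem G} {S : Set R.Face}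
  {a b c : V} {T : Finset V}

theorem exists_isDisk_of_triangle (hR : R.IsPlane) (hab : G.Adj a b) (hbc : G.Adj b c)
    (hca : G.Adj c a) : ∃ S, R.IsDisk S a [b, c, a] ∧ R.IsDisk Sᶜ a [c, b, a] := by
  have := hab.ne
  have := hbc.ne
  have := hca.ne
  obtain ⟨S, hSab, hS⟩ := exists_bd_and_bd_iff_mem_edges hR (c := a) (v := b)
    (t := .cons hab (.cons hbc (.cons hca .nil)))
    (by grind [SimpleGraph.Walk.isTrail_cons, SimpleGraph.Walk.IsTrail.nil,
      SimpleGraph.Walk.edges_cons, SimpleGraph.Walk.edges_nil, Sym2.eq_iff]) (by simp)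
  simp only [SimpleGraph.Walk.edges_cons, SimpleGraph.Walk.edges_nil, List.mem_cons,
    List.not_mem_nil, or_false, Sym2.eq_iff] at hS
  have hSbc : R.Bd S b c := by
    obtain ⟨d, hd⟩ := hSab.exists_out
    grind [Bd]
  have hSca : R.Bd S c a := by
    obtain ⟨d, hd⟩ := hSbc.exists_out
    grind [Bd]
  refine ⟨S, ⟨by grind, rfl, fun i j => ?_⟩, ⟨by grind, rfl, fun i j => ?_⟩⟩
  · simp only [pair_infix_cons_cons, not_pair_infix_singleton]
    grind [Bd]
  · rw [bd_compl_iff]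
    simp only [pair_infix_cons_cons, not_pair_infix_singleton]
    grind [Bd]

section Triangle

variable [DecidableEq V] {K : Type*} [CommSemiring K] [NoZeroDivisors K]
  {L : Sym2 V → MvPolynomial V K}

theorem IsDisk.exists_mem_support_prod_sdiff_sym2 [Nontrivial K] (hL : IsEdgeForm G L)
    (hR : R.IsPlaneTriangulation) (h : R.IsDisk S a [b, c, a]) :
    ∃ N ∈ (∏ e ∈ R.edges S \ ({a, b, c} : Finset V).sym2, L e).support,
      (∀ z ∈ ({a, b, c} : Finset V), N z = 0) ∧ ∀ z, N z ≤ 4 := by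
  obtain ⟨N, hN, hdeg⟩ := h.exists_mem_support_prod hL hR
  have hbc : R.Bd S b c := by simp [h.bd_iff, pair_infix_cons_cons]
  have hca : R.Bd S c a := by simp [h.bd_iff, pair_infix_cons_cons]
  have hnodup := h.nodup
  have herase : (R.edges S).erase s(b, a) =
      insert s(c, a) (insert s(c, b) (R.edges S \ ({a, b, c} : Finset V).sym2)) := by
    ext e
    have h₁ : s(c, a) ∈ R.edges S := mk_mem_edges.2 (.inl hca.1)
    have h₂ : s(c, b) ∈ R.edges S := mk_mem_edges.2 (.inr hbc.1)
    induction e with | _ i j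
    have hij : s(i, j) ∈ R.edges S → i ≠ j := fun h => (mem_edgeSet_of_mem_edges h).ne
    simp only [Finset.mem_erase, Finset.mem_insert, Finset.mem_sdiff, Finset.mk_mem_sym2_iff,
      Finset.mem_singleton]
    grind [Sym2.eq_iff]
  obtain ⟨u₁, u₂, -, -, hu⟩ := hL c a hca.1.adj
  obtain ⟨w₁, w₂, -, -, hw⟩ := hL c b hbc.1.adj.symm
  rw [herase, Finset.prod_insert (by grind [Sym2.eq_iff, Finset.mk_mem_sym2_iff]),
    Finset.prod_insert (by simp), hu, hw] at hN
  obtain ⟨M, hM, rfl⟩ :=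
    exists_eq_add_single_of_mem_support_linear_mul hdeg.right hN
  have hMb : M b = 0 := (Nat.add_eq_zero_iff.1 hdeg.left).1
  obtain ⟨M', hM', rfl⟩ := exists_eq_add_single_of_mem_support_linear_mul hMb hM
  have hc := hdeg.boundary c (by simp)
  have h₁ := hdeg.left
  have h₂ := hdeg.right
  simp only [Finsupp.add_apply, Finsupp.single_eq_same] at hc h₁ h₂
  refine ⟨M', hM', ?_, fun z => ?_⟩
  · simp only [Finset.mem_insert, Finset.mem_singleton]
    rintro z (rfl | rfl | rfl) <;> omega
  · have := hdeg.le_four z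
    simp only [Finsupp.add_apply] at this
    omega

theorem exists_mem_support_prod_of_vertices_inter_subset (hL : IsEdgeForm G L)
    (hT : R.vertices S ∩ R.vertices Sᶜ ⊆ T)
    (h₁ : ∃ N ∈ (∏ e ∈ R.edges S \ T.sym2, L e).support, (∀ z ∈ T, N z = 0) ∧ ∀ z, N z ≤ 4)
    (h₂ : ∃ N ∈ (∏ e ∈ R.edges Sᶜ \ T.sym2, L e).support, (∀ z ∈ T, N z = 0) ∧ ∀ z, N z ≤ 4) :
    ∃ N ∈ (∏ e ∈ R.edges Set.univ \ T.sym2, L e).support,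
      (∀ z ∈ T, N z = 0) ∧ ∀ z, N z ≤ 4 := by
  obtain ⟨N₁, hN₁, hT₁, h₁⟩ := h₁
  obtain ⟨N₂, hN₂, hT₂, h₂⟩ := h₂
  have hE (S : Set R.Face) (e : Sym2 V) (he : e ∈ R.edges S \ T.sym2) : e ∈ G.edgeSet :=
    mem_edgeSet_of_mem_edges (Finset.sdiff_subset he)
  have hvertex {S : Set R.Face} {e : Sym2 V} (he : e ∈ R.edges S \ T.sym2) {z : V} (hz : z ∈ e) :
      z ∈ R.vertices S := mem_vertices_of_mem_edges (Finset.sdiff_subset he) hz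
  have hzero₁ (z : V) (hz : z ∉ R.vertices S) : N₁ z = 0 :=
    hL.eq_zero_of_mem_support_prod (hE S) hN₁ fun _ he hze => hz (hvertex he hze)
  have hzero₂ (z : V) (hz : z ∈ R.vertices S) : N₂ z = 0 := by
    by_cases hz' : z ∈ R.vertices Sᶜ
    · exact hT₂ z (hT ⟨hz, hz'⟩)
    · exact hL.eq_zero_of_mem_support_prod (hE Sᶜ) hN₂ fun _ he hze => hz' (hvertex he hze)
  have hdisj : Disjoint (R.edges S \ T.sym2) (R.edges Sᶜ \ T.sym2) :=
    Finset.disjoint_left.2 fun e he he' => (Finset.mem_sdiff.1 he).2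
      (Finset.mem_sym2_iff.2 fun z hz => hT ⟨hvertex he hz, hvertex he' hz⟩)
  refine ⟨N₁ + N₂, ?_, fun z hz => by simp [hT₁ z hz, hT₂ z hz], fun z => ?_⟩
  · rw [← edges_diff_union_edges (Set.subset_univ S), ← Set.compl_eq_univ_sdiff, Finset.union_comm,
      Finset.union_sdiff_distrib]
    exact hL.add_mem_support_prod_union (hE _) (hE _) hdisj hN₁ hN₂
      fun e he z hz => hzero₂ z (hvertex he hz)
  · rw [Finsupp.add_apply]
    by_cases hz : z ∈ R.vertices S
    · simpa [hzero₂ z hz] using h₁ z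
    · simpa [hzero₁ z hz] using h₂ z

theorem exists_mem_support_prod_of_triangle [Nontrivial K] (hL : IsEdgeForm G L)
    (hR : R.IsPlaneTriangulation) (hT : G.IsNClique 3 T) :
    ∃ N ∈ (∏ e ∈ R.edges Set.univ \ T.sym2, L e).support,
      (∀ z ∈ T, N z = 0) ∧ ∀ z, N z ≤ 4 := by
  obtain ⟨a, b, c, hab, hac, hbc, rfl⟩ := SimpleGraph.is3Clique_iff.1 hT
  obtain ⟨S, hS, hS'⟩ := exists_isDisk_of_triangle hR.1 hab hbc hac.symm
  refine exists_mem_support_prod_of_vertices_inter_subset hL (fun z hz => ?_)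
    (hS.exists_mem_support_prod_sdiff_sym2 hL hR)
    (Finset.pair_comm b c ▸ hS'.exists_mem_support_prod_sdiff_sym2 hL hR)
  obtain ⟨_, hz⟩ := exists_bd_of_mem_vertices_of_disjoint disjoint_compl_right hz.1 hz.2
  simpa [or_comm, or_left_comm, or_assoc] using hS.mem_of_bd_left hz

end Triangle

theorem edgeFinset_deleteEdges_eq [DecidableEq V] (R : RotationSystem G) (T : Finset (Sym2 V))
    [Fintype (G.deleteEdges (T : Set (Sym2 V))).edgeSet] :
    (G.deleteEdges (T : Set (Sym2 V))).edgeFinset = R.edges Set.univ \ T := by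
  ext e
  induction e with | _ i j
  simp [mk_mem_edges, Left, G.adj_comm j i]

end RotationSystem

theorem mainTheorem8_general {V : Type*} [Fintype V] {G : SimpleGraph V}
    {R : RotationSystem G} (hR : R.IsPlaneTriangulation)
    {T : Finset V} (hT : G.IsNClique 3 T)
    {K : Type*} [CommSemiring K] [NoZeroDivisors K] [Nontrivial K]
    [Fintype (G.deleteEdges (T.sym2 : Set (Sym2 V))).edgeSet] {L : Sym2 V → MvPolynomial V K}
    (hL : IsEdgeForm (G.deleteEdges (T.sym2 : Set (Sym2 V))) L) :
    ∃ N : V →₀ ℕ,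
      MvPolynomial.coeff N
          (∏ e ∈ (G.deleteEdges (T.sym2 : Set (Sym2 V))).edgeFinset, L e) ≠ 0 ∧
      (∀ u ∈ T, N u = 0) ∧ ∀ w, N w ≤ 4 := by
  classical
  obtain ⟨L', hL', hLL'⟩ := hL.exists_eqOn G
  obtain ⟨N, hN, hNT⟩ := R.exists_mem_support_prod_of_triangle hL' hR hT
  refine ⟨N, ?_, hNT⟩
  rw [← Finset.prod_congr rfl fun e he => hLL' (SimpleGraph.mem_edgeFinset.1 he),
    R.edgeFinset_deleteEdges_eq]
  exact MvPolynomial.mem_support_iff.1 hN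

theorem mainTheorem8 {V : Type*} [Fintype V] [LinearOrder V] (G : SimpleGraph V)
    (R : RotationSystem G) (hR : R.IsPlaneTriangulation)
    (T : Finset V) (hT : G.IsNClique 3 T)
    {F : Type*} [Field F]
    (δ : EdgeDecoration (G.deleteEdges (T.sym2 : Set (Sym2 V))) F) :
    ∃ N : V →₀ ℕ,
      MvPolynomial.coeff N
          (decoratedPolynomial (G.deleteEdges (T.sym2 : Set (Sym2 V))) δ) ≠ 0 ∧
      (∀ u ∈ T, N u = 0) ∧
      (∀ w : V, w ∉ T → N w ≤ 4) := by
  classical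
  obtain ⟨N, hN, hNT, hN4⟩ := mainTheorem8_general hR hT δ.isEdgeForm
  refine ⟨N, ?_, hNT, fun w _ => hN4 w⟩
  rw [decoratedPolynomial]
  convert hN
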